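/- Let $n, s, t, l$ be integers with $n \ge 10$, $s, t \ge 2$, $l \ge 1$ and $n \ge s+t+l$, and put $m = n-s-t-l$. Write $[x,y] = x^{-1}y^{-1}xy$, and let $$R = \{\rho_0^2,\ \rho_1^2,\ \rho_2^2,\ (\rho_0\rho_1)^{2^s},\ (\rho_1\rho_2)^{2^t},\ (\rho_0\rho_2)^{2^l},\ [(\rho_0\rho_1)^4,\rho_2],\ [\rho_0,(\rho_1\rho_2)^4],\ [(\rho_0\rho_2)^2,\rho_1]\}.$$ Let $$G = \begin{cases}\langle \rho_0,\rho_1,\rho_2 \mid R,\ [(\rho_0\rho_1)^2,\rho_2]^{2^{m/2}}\rangle, & m \text{ even},\\ \langle \rho_0,\rho_1,\rho_2 \mid R,\ [(\rho_0\rho_1)^2,(\rho_1\rho_2)^2]^{2^{(m-1)/2}}\rangle, & m \text{ odd}.\end{cases}$$ Then $|G| = 2^n$, and $(G,\{\rho_0,\rho_1,\rho_2\})$ is a C-group: $\rho_0,\rho_1,\rho_2$ are involutions generating $G$, and $\langle \rho_i : i \in J\rangle \cap \langle \rho_i : i \in K\rangle = \langle \rho_i : i \in J \cap K\rangle$ for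 all $J, K \subseteq \{0,1,2\}$. Let $G_i = \langle \rho_j : j \ne i\rangle$ and let $\Gamma$ be the coset geometry of $G$ with respect to $(G_0,G_1,G_2)$: its elements of type $i$ are the right cosets of $G_i$, and two elements are incident when the cosets intersect. Then $\Gamma$ is a hypertope of rank $3$ (every flag lies in a chamber; every residue of rank at least $2$ has a connected incidence graph; every residue of rank $1$ has exactly two elements). It is flag-transitive (the group $\mathrm{Aut}_I(\Gamma)$ of type-preserving automorphisms is transitive on the flags of each type) and regular ($\mathrm{Aut}_I(\Gamma)$ acts regularly on the chambers). It has type $(2^s,2^t,2^l)$: the residues of the elements of type $2$, $0$, $1$ are respectively $2^s$-gons, $2^t$-gons, $2^l$-gons, and $\rho_0\rho_1$, $\rho_1\rho_2$, $\rho_0\rho_2$ have orders $2^s$, $2^t$, $2^l$ in $G$. Its automorphism group is $G$: the action of $G$ on cosets by right multiplication, in which $g$ maps $G_ix$ to $G_ixg^{-1}$, gives an isomorphism $G \cong \mathrm{Aut}_I(\Gamma)$. Moreover, $$G \cong \begin{cases}(C_{2^{s-2}}\times C_{2^{t-2}}\times C_{2^{l-1}}).\bigl((D_{2^{(m+4)/2}}\times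 D_{2^{(m+4)/2}})\rtimes C_2\bigr), & m \text{ even},\\ (C_{2^{s-2}}\times C_{2^{t-2}}\times C_{2^{l-1}}).\bigl((D_{2^{(m+3)/2}}\times D_{2^{(m+3)/2}})\rtimes (C_2\times C_2)\bigr), & m \text{ odd},\end{cases}$$ where $C_k$ is the cyclic group of order $k$, $D_{2k}$ is the dihedral group of order $2k$ (with $D_4 = C_2\times C_2$), $\rtimes$ is a semidirect product for some action, and $K.Q$ is a group with a normal subgroup isomorphic to $K$ whose quotient is isomorphic to $Q$. -/

import Mathlib

/-! ### Incidence systems and hypertopes -/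

/-- An incidence system with set of elements `X` and set of types `I`. -/
structure IncidenceSystem (X I : Type*) where
  /-- the type function -/
  type : X → I
  /-- the incidence relation -/
  Inc : X → X → Prop
  refl : ∀ x, Inc x x
  symm : ∀ x y, Inc x y → Inc y x
  eq_of_type_eq : ∀ x y, Inc x y → type x = type y → x = y

namespace IncidenceSystem

/-- The incidence graph: distinct elements are joined when they are incident. -/
def incidenceGraph {X I : Type*} (Γ : IncidenceSystem X I) : SimpleGraph X where
  Adj x y := x ≠ y ∧ Γ.Inc x y
  symm := ⟨fun x y h => ⟨h.1.symm, Γ.symm x y h.2⟩⟩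
  loopless := ⟨fun _ h => h.1 rfl⟩

/-- A flag is a set of pairwise incident elements. -/
def IsFlag {X I : Type*} (Γ : IncidenceSystem X I) (F : Set X) : Prop :=
  ∀ x ∈ F, ∀ y ∈ F, Γ.Inc x y

/-- The type of a flag is the set of the types of its elements. -/
def flagType {X I : Type*} (Γ : IncidenceSystem X I) (F : Set X) : Set I := Γ.type '' F

/-- A chamber is a flag of type `I`. -/
def IsChamber {X I : Type*} (Γ : IncidenceSystem X I) (C : Set X) : Prop :=
  Γ.IsFlag C ∧ Γ.flagType C = Set.univ

/-- An incidence geometry: every flag is contained in a chamber. -/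
def IsGeometry {X I : Type*} (Γ : IncidenceSystem X I) : Prop :=
  ∀ F, Γ.IsFlag F → ∃ C, Γ.IsChamber C ∧ F ⊆ C

/-- The rank is the number of types. -/
noncomputable def rank {X I : Type*} (_Γ : IncidenceSystem X I) : ℕ∞ := ENat.card I

/-- The elements of the residue of `F`: the elements outside `F` incident to all of `F`. -/
def ResidueElement {X I : Type*} (Γ : IncidenceSystem X I) (F : Set X) : Type _ :=
  {x : X // x ∉ F ∧ ∀ y ∈ F, Γ.Inc x y}

/-- The types of the residue of `F`: the types that do not occur in `F`. -/
def ResidueType {X I : Type*} (Γ : IncidenceSystem X I) (F : Set X) : Type _ :=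
  {i : I // i ∉ Γ.flagType F}

/-- The residue of `F`, with the restricted type function and incidence relation. -/
def residue {X I : Type*} (Γ : IncidenceSystem X I) (F : Set X) :
    IncidenceSystem (Γ.ResidueElement F) (Γ.ResidueType F) where
  type x := ⟨Γ.type x.1, by
    rintro ⟨y, hy, hxy⟩
    exact x.2.1 (Γ.eq_of_type_eq x.1 y (x.2.2 y hy) hxy.symm ▸ hy)⟩
  Inc x y := Γ.Inc x.1 y.1
  refl x := Γ.refl x.1
  symm x y h := Γ.symm x.1 y.1 h
  eq_of_type_eq x y h e := Subtype.ext (Γ.eq_of_type_eq x.1 y.1 h (congrArg Subtype.val e))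

/-- Residually connected: every residue of rank at least two has a connected incidence graph. -/
def IsResiduallyConnected {X I : Type*} (Γ : IncidenceSystem X I) : Prop :=
  ∀ F, Γ.IsFlag F → 2 ≤ (Γ.residue F).rank → (Γ.residue F).incidenceGraph.Connected

/-- Thin: every residue of rank one contains exactly two elements. -/
def IsThin {X I : Type*} (Γ : IncidenceSystem X I) : Prop :=
  ∀ F, Γ.IsFlag F → (Γ.residue F).rank = 1 → Nat.card (Γ.ResidueElement F) = 2

/-- A hypertope is a residually connected thin incidence geometry. -/
def IsHypertope {X I : Type*} (Γ : IncidenceSystem X I) : Prop :=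
  Γ.IsGeometry ∧ Γ.IsResiduallyConnected ∧ Γ.IsThin

/-- The group of type-preserving automorphisms. -/
def autI {X I : Type*} (Γ : IncidenceSystem X I) : Subgroup (Equiv.Perm X) where
  carrier := {α | (∀ x y, Γ.Inc (α x) (α y) ↔ Γ.Inc x y) ∧ ∀ x, Γ.type (α x) = Γ.type x}
  one_mem' := ⟨fun _ _ => Iff.rfl, fun _ => rfl⟩
  mul_mem' {α β} hα hβ :=
    ⟨fun x y => (hα.1 (β x) (β y)).trans (hβ.1 x y), fun x => (hα.2 (β x)).trans (hβ.2 x)⟩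
  inv_mem' {α} hα :=
    ⟨fun x y => by simpa using (hα.1 (α⁻¹ x) (α⁻¹ y)).symm,
     fun x => by simpa using (hα.2 (α⁻¹ x)).symm⟩

/-- Flag-transitive: type-preserving automorphisms act transitively on the flags of each type. -/
def IsFlagTransitive {X I : Type*} (Γ : IncidenceSystem X I) : Prop :=
  ∀ F F', Γ.IsFlag F → Γ.IsFlag F' → Γ.flagType F = Γ.flagType F' →
    ∃ α : Equiv.Perm X, α ∈ Γ.autI ∧ α '' F = F'

/-- Regular: type-preserving automorphisms act regularly on the chambers. -/
def IsRegular {X I : Type*} (Γ : IncidenceSystem X I) : Prop :=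
  ∀ C C', Γ.IsChamber C → Γ.IsChamber C' → ∃! α : Equiv.Perm X, α ∈ Γ.autI ∧ α '' C = C'

/-- The incidence graph is a cycle of length `2 * m` (a connected graph with `2 * m` vertices,
all of valency two), so that the incidence system is that of an `m`-gon. -/
def IsPolygon {X I : Type*} (Γ : IncidenceSystem X I) (m : ℕ) : Prop :=
  Γ.incidenceGraph.Connected ∧ Nat.card X = 2 * m ∧
    ∀ x, (Γ.incidenceGraph.neighborSet x).ncard = 2

/-- Type `(p, q, r)` in rank three: the residues with types `{0, 1}`, `{1, 2}`, `{0, 2}`, that is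
those of elements of type `2`, `0`, `1`, are respectively `p`-gons, `q`-gons, `r`-gons. -/
def HasType {X : Type*} (Γ : IncidenceSystem X (Fin 3)) (p q r : ℕ) : Prop :=
  (∀ x, Γ.type x = 2 → (Γ.residue {x}).IsPolygon p) ∧
  (∀ x, Γ.type x = 0 → (Γ.residue {x}).IsPolygon q) ∧
  (∀ x, Γ.type x = 1 → (Γ.residue {x}).IsPolygon r)

end IncidenceSystem

/-! ### Coset geometries and C-groups -/

/-- The elements of the coset geometry: pairs of a type `i` and a right coset of `H i`. -/
def CosetElement {G I : Type*} [Group G] (H : I → Subgroup G) : Type _ :=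
  Σ i : I, Quotient (QuotientGroup.rightRel (H i))

/-- The right coset of `H i` through `x`, as an element of type `i`. -/
def CosetElement.mk {G I : Type*} [Group G] (H : I → Subgroup G) (i : I) (x : G) :
    CosetElement H :=
  ⟨i, Quotient.mk (QuotientGroup.rightRel (H i)) x⟩

/-- The right coset as a subset of the group. -/
def CosetElement.carrier {G I : Type*} [Group G] {H : I → Subgroup G} (c : CosetElement H) :
    Set G :=
  {g | Quotient.mk (QuotientGroup.rightRel (H c.1)) g = c.2}

/-- The coset geometry: two right cosets are incident when they intersect. -/
def cosetGeometry {G I : Type*} [Group G] (H : I → Subgroup G) :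
    IncidenceSystem (CosetElement H) I where
  type c := c.1
  Inc c d := (c.carrier ∩ d.carrier).Nonempty
  refl c := by
    obtain ⟨g, hg⟩ := Quotient.exists_rep c.2
    exact ⟨g, hg, hg⟩
  symm c d h := by rwa [Set.inter_comm]
  eq_of_type_eq := by
    rintro ⟨i, c⟩ ⟨j, d⟩ ⟨g, hc, hd⟩ (rfl : i = j)
    exact congrArg (Sigma.mk i) (Eq.trans (Eq.symm hc) hd)

/-- The subgroup generated by the `ρ j` with `j ∈ J`. -/
def parabolic {G ι : Type*} [Group G] (ρ : ι → G) (J : Set ι) : Subgroup G :=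
  Subgroup.closure (ρ '' J)

/-- `(G, {ρ i})` is a C-group: the `ρ i` are involutions that generate `G` and satisfy the
intersection property. (The intersection property makes the `ρ i` pairwise distinct.) -/
def IsCGroup {G ι : Type*} [Group G] (ρ : ι → G) : Prop :=
  parabolic ρ Set.univ = ⊤ ∧ (∀ i, orderOf (ρ i) = 2) ∧
    ∀ J K : Set ι, parabolic ρ J ⊓ parabolic ρ K = parabolic ρ (J ∩ K)

/-- The subgroup generated by all the `ρ j` with `j ≠ i`. -/
def maximalParabolic {G ι : Type*} [Group G] (ρ : ι → G) (i : ι) : Subgroup G :=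
  parabolic ρ {i}ᶜ

/-! ### The presented groups -/

/-- The commutator `x⁻¹ y⁻¹ x y`. -/
def comm' {G : Type*} [Group G] (x y : G) : G := x⁻¹ * y⁻¹ * x * y

/-- The relators common to both parities, as words in `a`, `b`, `c`. -/
def baseRelators {G : Type*} [Group G] (s t l : ℕ) (a b c : G) : Set G :=
  {a ^ 2, b ^ 2, c ^ 2, (a * b) ^ 2 ^ s, (b * c) ^ 2 ^ t, (a * c) ^ 2 ^ l,
    comm' ((a * b) ^ 4) c, comm' a ((b * c) ^ 4), comm' ((a * c) ^ 2) b}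

/-- The additional relator, where `m` is `n - s - t - l`. -/
def lastRelator {G : Type*} [Group G] (m : ℕ) (a b c : G) : G :=
  if Even m then comm' ((a * b) ^ 2) c ^ 2 ^ (m / 2)
  else comm' ((a * b) ^ 2) ((b * c) ^ 2) ^ 2 ^ ((m - 1) / 2)

/-- The relators of the group, in the free group on three generators. -/
def hypertopeRelators (n s t l : ℕ) : Set (FreeGroup (Fin 3)) :=
  baseRelators s t l (FreeGroup.of 0) (FreeGroup.of 1) (FreeGroup.of 2) ∪
    {lastRelator (n - s - t - l) (FreeGroup.of 0) (FreeGroup.of 1) (FreeGroup.of 2)}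

/-- The group presented by three generators and the relators above. -/
abbrev HypertopeGroup (n s t l : ℕ) : Type := PresentedGroup (hypertopeRelators n s t l)

/-- The three generators of the presented group. -/
def hypertopeGen (n s t l : ℕ) (i : Fin 3) : HypertopeGroup n s t l := PresentedGroup.of i

/-- The coset geometry of the presented group and its three subgroups generated by two of the
generators. -/
def hypertopeGeometry (n s t l : ℕ) :
    IncidenceSystem (CosetElement (maximalParabolic (hypertopeGen n s t l))) (Fin 3) :=
  cosetGeometry (maximalParabolic (hypertopeGen n s t l))

/-! ### Group extensions -/

/-- The cyclic group of order `k` (for `k ≠ 0`). -/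
abbrev Cyc (k : ℕ) : Type := Multiplicative (ZMod k)

/-- `G` is an extension `K.Q`: it has a normal subgroup isomorphic to `K` with quotient
isomorphic to `Q`. -/
def IsExtensionOf (G K Q : Type*) [Group G] [Group K] [Group Q] : Prop :=
  ∃ (N : Subgroup G) (_ : N.Normal), Nonempty (N ≃* K) ∧ Nonempty (G ⧸ N ≃* Q)

/-!
# Regular hypertopes of order a power of two

Two observations carry the proof.

*Every generator can be killed.* If one of `a = ρ₀`, `b = ρ₁`, `c = ρ₂` is replaced by `1`, the
commutators in the relators become trivial, the last one included, and the only remaining relation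
that does not follow from `ρ i ^ 2 = 1` is the order of the product of the other two generators.
Hence for each set `J` of indices there is an endomorphism of the group that fixes the `ρ j` with
`j ∈ J` and kills the others (`HasRetractions`, `hasRetractions_hypertopeGen`). These retractions
preserve all parabolic subgroups. This gives the intersection property
(`HasRetractions.parabolic_inf`) and, for the coset geometry, the fact that a flag consists of
cosets through a common point (`HasRetractions.exists_eq_cosetFlag`). Chambers are thus
parametrized by the group, adjacent chambers by left multiplication by generators, and
connectedness, thinness, transitivity, regularity and the shape of the residues follow formally.
In the same way, killing one generator maps the group onto dihedral groups of orders `2 ^ (s +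
1)`, `2 ^ (t + 1)`, `2 ^ (l + 1)`, which determines the orders of the products and the parabolic
subgroups of rank two.

*The abelian normal subgroup.* The elements `(a b) ^ 4`, `(b c) ^ 4`, `(a c) ^ 2` are each
centralized or inverted by all generators, so they generate an abelian normal subgroup `N`, and
the three dihedral quotients, each of which kills two of them, show that `N` is the direct product
of cyclic groups of orders `2 ^ (s - 2)`, `2 ^ (t - 2)`, `2 ^ (l - 1)`
(`SatisfiesRelators.kernelHom_injective`). The quotient by `N` is the Coxeter group of type `{4,
4}`, the symmetry group of the square tessellation, modulo the normal closure of a power of a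
translation, which is parallel to an axis for even `m` and to a diagonal for odd `m`. In the even
case the reflections in lines parallel to the axes generate a product of two dihedral groups,
complemented by `b`; in the odd case those in lines parallel to the diagonals do, complemented by
`⟨a, c⟩`. These semidirect products are written down explicitly (`EvenModel`, `OddModel`),
together with their universal properties (`EvenModel.exists_hom`, `OddModel.exists_hom`), which
identify them with the quotient by `N` (`isExtensionOf_hypertopeGroup`).
-/

/-! ### Retractions onto parabolic subgroups -/

section Retractions

variable {G ι : Type*} [Group G] {ρ : ι → G}

/-- For every set `J` of indices, there is an endomorphism of `G` that fixes the `ρ j` with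
`j ∈ J` and kills the others. It is a retraction onto the parabolic subgroup of `J`. -/
def HasRetractions (ρ : ι → G) : Prop :=
  ∀ J : Set ι, ∃ f : G →* G, (∀ j ∈ J, f (ρ j) = ρ j) ∧ ∀ j ∉ J, f (ρ j) = 1

lemma mem_parabolic {J : Set ι} {j : ι} (hj : j ∈ J) : ρ j ∈ parabolic ρ J :=
  Subgroup.subset_closure ⟨j, hj, rfl⟩

lemma parabolic_mono {J K : Set ι} (h : J ⊆ K) : parabolic ρ J ≤ parabolic ρ K :=
  Subgroup.closure_mono (Set.image_mono h)

lemma mem_maximalParabolic {i j : ι} (h : j ≠ i) : ρ j ∈ maximalParabolic ρ i :=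
  mem_parabolic h

lemma map_mem_parabolic_inter {J : Set ι} {f : G →* G} (hf : ∀ j ∈ J, f (ρ j) = ρ j)
    (hf' : ∀ j ∉ J, f (ρ j) = 1) {K : Set ι} {x : G} (hx : x ∈ parabolic ρ K) :
    f x ∈ parabolic ρ (J ∩ K) := by
  suffices parabolic ρ K ≤ (parabolic ρ (J ∩ K)).comap f from this hx
  refine (Subgroup.closure_le _).2 ?_
  rintro _ ⟨k, hk, rfl⟩
  by_cases hJ : k ∈ J
  · simpa [hf k hJ] using mem_parabolic (ρ := ρ) (J := J ∩ K) ⟨hJ, hk⟩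
  · simp [hf' k hJ, one_mem]

lemma map_eq_of_mem_parabolic {J : Set ι} {f : G →* G} (hf : ∀ j ∈ J, f (ρ j) = ρ j)
    {x : G} (hx : x ∈ parabolic ρ J) : f x = x := by
  suffices parabolic ρ J ≤ f.eqLocus (MonoidHom.id G) from this hx
  refine (Subgroup.closure_le _).2 ?_
  rintro _ ⟨k, hk, rfl⟩
  exact hf k hk

/-- The intersection property: a retraction onto the parabolic subgroup of `J` fixes every `x` in
the intersection, and it maps the parabolic subgroup of `K` into that of `J ∩ K`. -/
lemma HasRetractions.parabolic_inf (h : HasRetractions ρ) (J K : Set ι) :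
    parabolic ρ J ⊓ parabolic ρ K = parabolic ρ (J ∩ K) := by
  refine le_antisymm ?_ (le_inf (parabolic_mono Set.inter_subset_left)
    (parabolic_mono Set.inter_subset_right))
  rintro x ⟨hJ, hK⟩
  obtain ⟨f, hf, hf'⟩ := h J
  simpa [map_eq_of_mem_parabolic hf hJ] using map_mem_parabolic_inter hf hf' hK

/-- The intersection of the maximal parabolic subgroups of the types in `J` is generated by the
`ρ j` with `j ∉ J`. -/
lemma IsCGroup.mem_parabolic_compl [Finite ι] (hC : IsCGroup ρ) {J : Set ι} {x : G}
    (hx : ∀ i ∈ J, x ∈ maximalParabolic ρ i) : x ∈ parabolic ρ Jᶜ := by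
  induction J, J.toFinite using Set.Finite.induction_on with
  | empty => simp [hC.1]
  | @insert i T _ _ ih =>
    have hi : x ∈ maximalParabolic ρ i := hx i (Set.mem_insert i T)
    have := hC.2.2 {i}ᶜ Tᶜ ▸
      Subgroup.mem_inf.2 ⟨hi, ih fun j hj => hx j (Set.mem_insert_of_mem i hj)⟩
    rwa [← Set.compl_union, Set.singleton_union] at this

lemma IsCGroup.eq_one_of_forall_mem [Finite ι] (hC : IsCGroup ρ) {x : G}
    (hx : ∀ i, x ∈ maximalParabolic ρ i) : x = 1 := by
  have := hC.mem_parabolic_compl (J := Set.univ) fun i _ => hx i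
  simpa [parabolic] using this

lemma IsCGroup.mul_self (hC : IsCGroup ρ) (i : ι) : ρ i * ρ i = 1 := by
  rw [← sq, ← hC.2.1 i, pow_orderOf_eq_one]

lemma IsCGroup.eq_one_or_eq [Finite ι] (hC : IsCGroup ρ) {k : ι} {x : G}
    (hx : ∀ i, i ≠ k → x ∈ maximalParabolic ρ i) : x = 1 ∨ x = ρ k := by
  have hx' := hC.mem_parabolic_compl (J := {k}ᶜ) hx
  rw [compl_compl, parabolic, Set.image_singleton, Subgroup.mem_closure_singleton] at hx'
  obtain ⟨n, rfl⟩ := hx'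
  obtain ⟨d, rfl | rfl⟩ := n.even_or_odd'
  · left
    rw [zpow_mul, zpow_ofNat, sq, hC.mul_self, one_zpow]
  · right
    rw [zpow_add, zpow_mul, zpow_ofNat, sq, hC.mul_self, one_zpow, one_mul, zpow_one]

lemma IsCGroup.notMem_maximalParabolic (hC : IsCGroup ρ) (i : ι) :
    ρ i ∉ maximalParabolic ρ i := fun hi => by
  have := hC.2.2 {i} {i}ᶜ ▸
    Subgroup.mem_inf.2 ⟨mem_parabolic (Set.mem_singleton i), hi⟩
  have h1 : ρ i = 1 := by simpa [parabolic] using this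
  simpa [h1] using hC.2.1 i

/-- If the coset of `z` modulo the maximal parabolic subgroup of type `j` meets those of the types
in `T`, then it meets their intersection: when `u` is a common element of the coset and the
maximal parabolic subgroup of type `i`, the retraction onto the latter fixes `u`, so it preserves
the coset, and it preserves all parabolic subgroups. -/
lemma HasRetractions.exists_mem_coset [Finite ι] (h : HasRetractions ρ)
    (hρ : parabolic ρ Set.univ = ⊤) (j : ι) (z : G)
    (T : Set ι) (hT : ∀ i ∈ T, ∃ u ∈ maximalParabolic ρ i, u * z⁻¹ ∈ maximalParabolic ρ j) :
    ∃ w, (∀ i ∈ T, w ∈ maximalParabolic ρ i) ∧ w * z⁻¹ ∈ maximalParabolic ρ j := by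
  induction T, T.toFinite using Set.Finite.induction_on with
  | empty => exact ⟨z, by simp, by simp [one_mem]⟩
  | @insert i T _ _ ih =>
    obtain ⟨w, hw, hwz⟩ := ih fun i' hi' => hT i' (Set.mem_insert_of_mem i hi')
    obtain ⟨u, hu, huz⟩ := hT i (Set.mem_insert i T)
    obtain ⟨f, hf, hf'⟩ := h {i}ᶜ
    have key {K : Set ι} {x : G} (hx : x ∈ parabolic ρ K) := map_mem_parabolic_inter hf hf' hx
    refine ⟨f w, ?_, ?_⟩
    · rintro i' (rfl | hi')
      · exact parabolic_mono Set.inter_subset_left (key (hρ ▸ Subgroup.mem_top w))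
      · exact parabolic_mono Set.inter_subset_right (key (hw i' hi'))
    · have h1 : w * u⁻¹ ∈ maximalParabolic ρ j := by
        simpa [mul_assoc] using mul_mem hwz (inv_mem huz)
      have h2 : f (w * u⁻¹) ∈ maximalParabolic ρ j :=
        parabolic_mono Set.inter_subset_right (key h1)
      rw [map_mul, map_inv, map_eq_of_mem_parabolic hf hu] at h2
      simpa [mul_assoc] using mul_mem h2 huz

end Retractions

/-! ### Elements and flags of a coset geometry -/

section CosetGeometry

variable {G ι : Type*} [Group G] {ρ : ι → G}

namespace CosetElement

variable {H : ι → Subgroup G}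

lemma mk_eq_mk {i : ι} {x y : G} : mk H i x = mk H i y ↔ y * x⁻¹ ∈ H i := by
  rw [← QuotientGroup.rightRel_apply]
  exact ⟨fun e => Quotient.exact (eq_of_heq (Sigma.mk.inj e).2),
    fun e => congrArg (Sigma.mk i) (Quotient.sound e)⟩

lemma mem_carrier_mk {i : ι} {g x : G} : g ∈ (mk H i x).carrier ↔ mk H i g = mk H i x :=
  ⟨fun e => congrArg (Sigma.mk i) e, fun e => eq_of_heq (Sigma.mk.inj e).2⟩

lemma exists_eq_mk (c : CosetElement H) : ∃ x, c = mk H c.1 x := by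
  obtain ⟨i, c⟩ := c
  obtain ⟨x, rfl⟩ := Quotient.exists_rep c
  exact ⟨x, rfl⟩

lemma mk_mul_of_mem {i : ι} {h x : G} (hh : h ∈ H i) : mk H i (h * x) = mk H i x :=
  mk_eq_mk.2 (by simpa using inv_mem hh)

lemma mk_mul_right_inj {i : ι} {x y g : G} : mk H i (x * g) = mk H i (y * g) ↔
    mk H i x = mk H i y := by
  rw [mk_eq_mk, mk_eq_mk]
  simp [mul_assoc]

end CosetElement

open CosetElement

lemma cosetGeometry_type_mk {H : ι → Subgroup G} (i : ι) (x : G) :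
    (cosetGeometry H).type (mk H i x) = i := rfl

lemma cosetGeometry_inc {H : ι → Subgroup G} {i j : ι} {x y : G} :
    (cosetGeometry H).Inc (mk H i x) (mk H j y) ↔
      ∃ g, mk H i g = mk H i x ∧ mk H j g = mk H j y := by
  simp only [cosetGeometry, Set.Nonempty, Set.mem_inter_iff, mem_carrier_mk]

/-- The set of the cosets through `x` whose type is in `J`. -/
def cosetFlag (H : ι → Subgroup G) (J : Set ι) (x : G) : Set (CosetElement H) :=
  (fun i => mk H i x) '' J

section

variable {H : ι → Subgroup G}

lemma isFlag_cosetFlag (J : Set ι) (x : G) : (cosetGeometry H).IsFlag (cosetFlag H J x) := by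
  rintro _ ⟨i, _, rfl⟩ _ ⟨j, _, rfl⟩
  exact cosetGeometry_inc.2 ⟨x, rfl, rfl⟩

lemma flagType_cosetFlag (J : Set ι) (x : G) :
    (cosetGeometry H).flagType (cosetFlag H J x) = J := by
  rw [IncidenceSystem.flagType, cosetFlag, Set.image_image]
  simp [cosetGeometry_type_mk]

lemma isChamber_cosetFlag (x : G) : (cosetGeometry H).IsChamber (cosetFlag H Set.univ x) :=
  ⟨isFlag_cosetFlag _ x, flagType_cosetFlag _ x⟩

lemma mk_mem_cosetFlag {J : Set ι} {i : ι} {x y : G} :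
    mk H i y ∈ cosetFlag H J x ↔ i ∈ J ∧ mk H i y = mk H i x := by
  constructor
  · rintro ⟨j, hj, h⟩
    obtain rfl : j = i := congrArg Sigma.fst h
    exact ⟨hj, h.symm⟩
  · rintro ⟨hi, h⟩
    exact ⟨i, hi, h.symm⟩

end

/-- The elements of a flag of the coset geometry have a common point. -/
lemma HasRetractions.exists_eq_cosetFlag [Finite ι] (h : HasRetractions ρ)
    (hρ : parabolic ρ Set.univ = ⊤) {F : Set (CosetElement (maximalParabolic ρ))}
    (hF : (cosetGeometry (maximalParabolic ρ)).IsFlag F) :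
    ∃ J x, F = cosetFlag (maximalParabolic ρ) J x := by
  suffices ∃ x, ∀ y ∈ F, y = mk _ y.1 x by
    obtain ⟨x, hx⟩ := this
    refine ⟨Sigma.fst '' F, x, Set.ext fun y => ⟨fun hy => ?_, ?_⟩⟩
    · exact ⟨y.1, ⟨y, hy, rfl⟩, (hx y hy).symm⟩
    · rintro ⟨_, ⟨y, hy, rfl⟩, rfl⟩
      exact hx y hy ▸ hy
  have hfin : F.Finite := Set.Finite.of_finite_image (f := Sigma.fst) (Set.toFinite _)
    fun x hx y hy hxy => (cosetGeometry _).eq_of_type_eq x y (hF x hx y hy) hxy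
  induction F, hfin using Set.Finite.induction_on with
  | empty => exact ⟨1, by simp⟩
  | @insert y F _ _ ih =>
    obtain ⟨x, hx⟩ := ih fun a ha b hb =>
      hF a (Set.mem_insert_of_mem y ha) b (Set.mem_insert_of_mem y hb)
    obtain ⟨z, hz⟩ := exists_eq_mk y
    -- translate by `x⁻¹`, so that the elements of `F` become maximal parabolic subgroups
    obtain ⟨w, hw, hwz⟩ := h.exists_mem_coset hρ y.1 (z * x⁻¹) (Sigma.fst '' F) (by
      rintro _ ⟨e, he, rfl⟩
      have := hF e (Set.mem_insert_of_mem y he) y (Set.mem_insert y F)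
      rw [hx e he, hz, cosetGeometry_inc] at this
      obtain ⟨g, hg, hg'⟩ := this
      rw [eq_comm, mk_eq_mk] at hg hg'
      exact ⟨g * x⁻¹, hg, by simpa [mul_assoc] using hg'⟩)
    refine ⟨w * x, ?_⟩
    rintro e (rfl | he)
    · refine hz.trans (mk_eq_mk.2 ?_)
      simpa [mul_assoc] using hwz
    · rw [mk_mul_of_mem (hw _ ⟨e, he, rfl⟩)]
      exact hx e he

lemma HasRetractions.isGeometry [Finite ι] (h : HasRetractions ρ)
    (hρ : parabolic ρ Set.univ = ⊤) : (cosetGeometry (maximalParabolic ρ)).IsGeometry := by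
  intro F hF
  obtain ⟨J, x, rfl⟩ := h.exists_eq_cosetFlag hρ hF
  exact ⟨_, isChamber_cosetFlag x, Set.image_mono (Set.subset_univ J)⟩

/-- An element incident with all cosets through `x` of types in `J` passes through `p * x` for some
`p` in the intersection of the corresponding subgroups. -/
lemma HasRetractions.exists_of_forall_inc [Finite ι] (h : HasRetractions ρ)
    (hC : IsCGroup ρ) {J : Set ι} {x : G} {y : CosetElement (maximalParabolic ρ)}
    (hy : ∀ e ∈ cosetFlag (maximalParabolic ρ) J x, (cosetGeometry _).Inc y e) :
    ∃ p ∈ parabolic ρ Jᶜ, y = mk _ y.1 (p * x) := by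
  have hF : (cosetGeometry _).IsFlag (insert y (cosetFlag (maximalParabolic ρ) J x)) := by
    rintro a (rfl | ha) b (rfl | hb)
    · exact (cosetGeometry _).refl _
    · exact hy b hb
    · exact (cosetGeometry _).symm _ _ (hy a ha)
    · exact isFlag_cosetFlag J x a ha b hb
  obtain ⟨K, w, hw⟩ := h.exists_eq_cosetFlag hC.1 hF
  obtain ⟨z, hz⟩ := exists_eq_mk y
  refine ⟨w * x⁻¹, hC.mem_parabolic_compl fun i hi => ?_, ?_⟩
  · have : mk _ i x ∈ cosetFlag (maximalParabolic ρ) K w :=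
      hw ▸ Set.mem_insert_of_mem _ ⟨i, hi, rfl⟩
    exact mk_eq_mk.1 (mk_mem_cosetFlag.1 this).2
  · have : y ∈ cosetFlag (maximalParabolic ρ) K w := hw ▸ Set.mem_insert _ _
    rw [hz, mk_mem_cosetFlag] at this
    rw [inv_mul_cancel_right]
    exact hz.trans this.2

/-! ### Residues of a coset geometry -/

lemma mk_mem_residue {H : ι → Subgroup G} {J : Set ι} {k : ι} (hk : k ∉ J) {p x : G}
    (hp : ∀ i ∈ J, p ∈ H i) :
    mk H k (p * x) ∉ cosetFlag H J x ∧
      ∀ y ∈ cosetFlag H J x, (cosetGeometry H).Inc (mk H k (p * x)) y := by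
  refine ⟨fun h => hk (mk_mem_cosetFlag.1 h).1, ?_⟩
  rintro _ ⟨i, hi, rfl⟩
  exact cosetGeometry_inc.2 ⟨p * x, rfl, mk_mul_of_mem (hp i hi)⟩

lemma mem_maximalParabolic_of_mem {J : Set ι} {p : G} (hp : p ∈ parabolic ρ Jᶜ) {i : ι}
    (hi : i ∈ J) : p ∈ maximalParabolic ρ i :=
  parabolic_mono (Set.compl_subset_compl.2 (Set.singleton_subset_iff.2 hi)) hp

/-- The element of type `k` through `p * x` of the residue of a flag through `x`. -/
def residueMk {J : Set ι} (x : G) (k : ↥Jᶜ) (p : parabolic ρ Jᶜ) :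
    (cosetGeometry (maximalParabolic ρ)).ResidueElement
      (cosetFlag (maximalParabolic ρ) J x) :=
  ⟨mk _ k (p * x), mk_mem_residue k.2 fun _ hi => mem_maximalParabolic_of_mem p.2 hi⟩

lemma HasRetractions.exists_eq_residueMk [Finite ι] (h : HasRetractions ρ) (hC : IsCGroup ρ)
    {J : Set ι} {x : G} (y : (cosetGeometry (maximalParabolic ρ)).ResidueElement
      (cosetFlag (maximalParabolic ρ) J x)) : ∃ k p, y = residueMk x k p := by
  obtain ⟨p, hp, hy⟩ := h.exists_of_forall_inc hC y.2.2
  have hk : y.1.1 ∉ J := fun hk => y.2.1 ⟨_, hk, by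
    rw [hy]
    exact (mk_mul_of_mem (mem_maximalParabolic_of_mem hp hk)).symm⟩
  exact ⟨⟨_, hk⟩, ⟨p, hp⟩, Subtype.ext hy⟩

lemma residueMk_eq_residueMk {J : Set ι} {x : G} {k k' : ↥Jᶜ} {p p' : parabolic ρ Jᶜ} :
    residueMk x k p = residueMk x k' p' ↔ k = k' ∧ (p' * p⁻¹ : G) ∈ maximalParabolic ρ k := by
  constructor
  · intro e
    have e' := congrArg Subtype.val e
    obtain rfl : k = k' := Subtype.ext (congrArg Sigma.fst e')
    exact ⟨rfl, mk_eq_mk.1 (mk_mul_right_inj.1 e')⟩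
  · rintro ⟨rfl, e⟩
    exact Subtype.ext (mk_mul_right_inj.2 (mk_eq_mk.2 e))

lemma residue_rank_cosetFlag {H : ι → Subgroup G} (J : Set ι) (x : G) :
    ((cosetGeometry H).residue (cosetFlag H J x)).rank = (Jᶜ).encard := by
  unfold IncidenceSystem.rank IncidenceSystem.ResidueType
  rw [flagType_cosetFlag]
  rfl

/-- The residue of a flag is connected: the elements through `p * x` are pairwise incident, and
each of them, except the one of type `j`, passes also through `ρ j * p * x`. -/
lemma HasRetractions.residue_connected [Finite ι] (h : HasRetractions ρ) (hC : IsCGroup ρ)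
    {J : Set ι} (hJ : Jᶜ.Nontrivial) (x : G) :
    ((cosetGeometry (maximalParabolic ρ)).residue
      (cosetFlag (maximalParabolic ρ) J x)).incidenceGraph.Connected := by
  set Γ := (cosetGeometry (maximalParabolic ρ)).residue
    (cosetFlag (maximalParabolic ρ) J x)
  have hinc (p : parabolic ρ Jᶜ) (k k' : ↥Jᶜ) :
      Γ.incidenceGraph.Reachable (residueMk x k p) (residueMk x k' p) := by
    by_cases e : residueMk x k p = residueMk x k' p
    · rw [e]
    · exact SimpleGraph.Adj.reachable ⟨e, cosetGeometry_inc.2 ⟨p * x, rfl, rfl⟩⟩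
  have hstep (j : ι) (p q : parabolic ρ Jᶜ)
      (hpq : ∀ i, i ≠ j → (q * p⁻¹ : G) ∈ maximalParabolic ρ i) (k : ↥Jᶜ) :
      ∃ i : ↥Jᶜ, Γ.incidenceGraph.Reachable (residueMk x k p) (residueMk x i q) := by
    obtain ⟨i, hi, hij⟩ := hJ.exists_ne j
    refine ⟨⟨i, hi⟩, ?_⟩
    rw [← (residueMk_eq_residueMk (k := ⟨i, hi⟩)).2 ⟨rfl, hpq i hij⟩]
    exact hinc p k ⟨i, hi⟩
  have hmain (p : G) (hp : p ∈ parabolic ρ Jᶜ) (k k' : ↥Jᶜ) :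
      Γ.incidenceGraph.Reachable (residueMk x k ⟨p, hp⟩) (residueMk x k' 1) := by
    induction hp using Subgroup.closure_induction_left generalizing k with
    | one => exact hinc 1 k k'
    | mul_left g hg p hp ih =>
      obtain ⟨j, hj, rfl⟩ := hg
      obtain ⟨i, hi⟩ := hstep j ⟨ρ j * p, mul_mem (mem_parabolic hj) hp⟩ ⟨p, hp⟩
        (fun i hi => by simpa using inv_mem (mem_maximalParabolic (ρ := ρ) hi.symm)) k
      exact hi.trans (ih i)
    | inv_mul_cancel g hg p hp ih =>
      obtain ⟨j, hj, rfl⟩ := hg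
      obtain ⟨i, hi⟩ := hstep j ⟨(ρ j)⁻¹ * p, mul_mem (inv_mem (mem_parabolic hj)) hp⟩ ⟨p, hp⟩
        (fun i hi => by simpa using mem_maximalParabolic (ρ := ρ) hi.symm) k
      exact hi.trans (ih i)
  obtain ⟨j, hj⟩ := hJ.nonempty
  rw [SimpleGraph.connected_iff]
  refine ⟨fun y y' => ?_, ⟨residueMk x ⟨j, hj⟩ 1⟩⟩
  obtain ⟨k, p, rfl⟩ := h.exists_eq_residueMk hC y
  obtain ⟨k', p', rfl⟩ := h.exists_eq_residueMk hC y'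
  exact (hmain p p.2 k k).trans (hmain p' p'.2 k' k).symm

lemma HasRetractions.isResiduallyConnected [Finite ι] (h : HasRetractions ρ)
    (hC : IsCGroup ρ) : (cosetGeometry (maximalParabolic ρ)).IsResiduallyConnected := by
  intro F hF hr
  obtain ⟨J, x, rfl⟩ := h.exists_eq_cosetFlag hC.1 hF
  rw [residue_rank_cosetFlag] at hr
  exact h.residue_connected hC
    (Set.one_lt_encard_iff_nontrivial.1 (lt_of_lt_of_le (by norm_num) hr)) x

/-- Exactly two elements of type `k` can be incident with all `mk i x` with `i ≠ k`, because the
intersection of the corresponding subgroups is `{1, ρ k}`. -/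
lemma HasRetractions.eq_or_eq_of_forall_inc [Finite ι] (h : HasRetractions ρ)
    (hC : IsCGroup ρ) {k : ι} {x : G} {y : CosetElement (maximalParabolic ρ)}
    (hk : y.1 = k) (hy : ∀ e ∈ cosetFlag (maximalParabolic ρ) {k}ᶜ x, (cosetGeometry _).Inc y e) :
    y = mk _ k x ∨ y = mk _ k (ρ k * x) := by
  obtain ⟨p, hp, e⟩ := h.exists_of_forall_inc hC hy
  subst hk
  rcases hC.eq_one_or_eq fun i hi => mem_maximalParabolic_of_mem hp hi with rfl | rfl
  · left
    rwa [one_mul] at e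
  · exact Or.inr e

lemma IsCGroup.mk_ne_mk (hC : IsCGroup ρ) (k : ι) (x : G) :
    mk (maximalParabolic ρ) k x ≠ mk _ k (ρ k * x) := fun e => by
  rw [mk_eq_mk] at e
  exact hC.notMem_maximalParabolic k (by simpa using e)

lemma HasRetractions.isThin [Finite ι] (h : HasRetractions ρ)
    (hC : IsCGroup ρ) : (cosetGeometry (maximalParabolic ρ)).IsThin := by
  intro F hF hr
  obtain ⟨J, x, rfl⟩ := h.exists_eq_cosetFlag hC.1 hF
  rw [residue_rank_cosetFlag, Set.encard_eq_one] at hr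
  obtain ⟨k, hk⟩ := hr
  obtain rfl : J = {k}ᶜ := by rw [← hk, compl_compl]
  have : {y | y ∉ cosetFlag (maximalParabolic ρ) {k}ᶜ x ∧
      ∀ e ∈ cosetFlag (maximalParabolic ρ) {k}ᶜ x, (cosetGeometry _).Inc y e} =
      {mk _ k x, mk _ k (ρ k * x)} := by
    refine Set.Subset.antisymm ?_ ?_
    · rintro y ⟨hy, hy'⟩
      refine h.eq_or_eq_of_forall_inc hC ?_ hy'
      obtain ⟨k', p, e⟩ := h.exists_eq_residueMk hC ⟨y, hy, hy'⟩
      have e' : y = mk (maximalParabolic ρ) k' (p * x) := congrArg Subtype.val e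
      rw [e']
      have := k'.2
      change (k' : ι) = k
      simpa using this
    · rintro y (rfl | rfl)
      · simpa using mk_mem_residue (H := maximalParabolic ρ) (x := x) (J := {k}ᶜ) (k := k) (by simp)
          fun i _ => one_mem (maximalParabolic ρ i)
      · exact mk_mem_residue (by simp) fun i hi => mem_maximalParabolic fun e => hi e.symm
  change Nat.card {y | y ∉ cosetFlag (maximalParabolic ρ) {k}ᶜ x ∧
      ∀ e ∈ cosetFlag (maximalParabolic ρ) {k}ᶜ x, (cosetGeometry _).Inc y e} = 2
  rw [this]
  exact Set.ncard_pair (hC.mk_ne_mk k x)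

lemma HasRetractions.isHypertope [Finite ι] (h : HasRetractions ρ)
    (hC : IsCGroup ρ) : (cosetGeometry (maximalParabolic ρ)).IsHypertope :=
  ⟨h.isGeometry hC.1, h.isResiduallyConnected hC, h.isThin hC⟩

end CosetGeometry

/-! ### The automorphism group of a coset geometry -/

section Automorphisms

variable {G ι : Type*} [Group G] {ρ : ι → G}

open CosetElement

/-- Right multiplication by `g⁻¹` on the cosets. -/
def cosetPerm (H : ι → Subgroup G) : G →* Equiv.Perm (CosetElement H) where
  toFun g :=
    { toFun := fun c => ⟨c.1, Quotient.map (· * g⁻¹) (fun x y h => by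
        rw [← Quotient.eq_iff_equiv, Quotient.eq, QuotientGroup.rightRel_apply] at h ⊢
        simpa [mul_assoc] using h) c.2⟩
      invFun := fun c => ⟨c.1, Quotient.map (· * g) (fun x y h => by
        rw [← Quotient.eq_iff_equiv, Quotient.eq, QuotientGroup.rightRel_apply] at h ⊢
        simpa [mul_assoc] using h) c.2⟩
      left_inv := fun c => by
        obtain ⟨x, hx⟩ := exists_eq_mk c
        rw [hx]
        exact congrArg (mk H c.1) (inv_mul_cancel_right x g)
      right_inv := fun c => by
        obtain ⟨x, hx⟩ := exists_eq_mk c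
        rw [hx]
        exact congrArg (mk H c.1) (mul_inv_cancel_right x g) }
  map_one' := Equiv.ext fun c => by
    obtain ⟨x, hx⟩ := exists_eq_mk c
    rw [hx]
    exact congrArg (mk H c.1) (by simp)
  map_mul' g h := Equiv.ext fun c => by
    obtain ⟨x, hx⟩ := exists_eq_mk c
    rw [hx]
    exact congrArg (mk H c.1) (by simp [mul_assoc])

lemma cosetPerm_mk (H : ι → Subgroup G) (g x : G) (i : ι) :
    cosetPerm H g (mk H i x) = mk H i (x * g⁻¹) := rfl

lemma cosetPerm_mem_autI (H : ι → Subgroup G) (g : G) :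
    cosetPerm H g ∈ (cosetGeometry H).autI := by
  refine ⟨fun c d => ?_, fun c => rfl⟩
  obtain ⟨x, hx⟩ := exists_eq_mk c
  obtain ⟨y, hy⟩ := exists_eq_mk d
  rw [hx, hy, cosetPerm_mk, cosetPerm_mk, cosetGeometry_inc, cosetGeometry_inc]
  constructor
  · rintro ⟨z, hz, hz'⟩
    exact ⟨z * g, by simpa using (mk_mul_right_inj (g := g)).2 hz,
      by simpa using (mk_mul_right_inj (g := g)).2 hz'⟩
  · rintro ⟨z, hz, hz'⟩
    exact ⟨z * g⁻¹, mk_mul_right_inj.2 hz, mk_mul_right_inj.2 hz'⟩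

lemma cosetPerm_image_cosetFlag (H : ι → Subgroup G) (J : Set ι) (g x : G) :
    cosetPerm H g '' cosetFlag H J x = cosetFlag H J (x * g⁻¹) := by
  rw [cosetFlag, Set.image_image]
  rfl

lemma HasRetractions.isFlagTransitive [Finite ι] (h : HasRetractions ρ)
    (hρ : parabolic ρ Set.univ = ⊤) : (cosetGeometry (maximalParabolic ρ)).IsFlagTransitive := by
  intro F F' hF hF' ht
  obtain ⟨J, x, rfl⟩ := h.exists_eq_cosetFlag hρ hF
  obtain ⟨J', x', rfl⟩ := h.exists_eq_cosetFlag hρ hF'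
  obtain rfl : J = J' := by simpa [flagType_cosetFlag] using ht
  exact ⟨cosetPerm _ (x'⁻¹ * x), cosetPerm_mem_autI _ _, by
    rw [cosetPerm_image_cosetFlag]
    simp⟩

lemma HasRetractions.exists_eq_chamber [Finite ι] (h : HasRetractions ρ)
    (hρ : parabolic ρ Set.univ = ⊤) {C : Set (CosetElement (maximalParabolic ρ))}
    (hCh : (cosetGeometry (maximalParabolic ρ)).IsChamber C) :
    ∃ x, C = cosetFlag (maximalParabolic ρ) Set.univ x := by
  obtain ⟨J, x, rfl⟩ := h.exists_eq_cosetFlag hρ hCh.1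
  have := hCh.2
  rw [flagType_cosetFlag] at this
  exact ⟨x, this ▸ rfl⟩

lemma apply_mk_of_image_eq {H : ι → Subgroup G} {α : Equiv.Perm (CosetElement H)}
    (hα : α ∈ (cosetGeometry H).autI) {x y : G}
    (h : α '' cosetFlag H Set.univ x = cosetFlag H Set.univ y) (i : ι) :
    α (mk H i x) = mk H i y := by
  have h1 : α (mk H i x) ∈ cosetFlag H Set.univ y := h ▸ ⟨_, ⟨i, trivial, rfl⟩, rfl⟩
  obtain ⟨j, -, hj⟩ := h1
  have h2 : (cosetGeometry H).type (α (mk H i x)) = i := hα.2 _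
  rw [← hj, cosetGeometry_type_mk] at h2
  rw [← hj]
  exact h2 ▸ rfl

/-- If a type-preserving automorphism fixes the elements through `x`, then it maps the one of
type `j` through `ρ j * x`, which is the only other element incident with those of the other types,
to itself. -/
lemma HasRetractions.apply_mk_mul [Finite ι] (h : HasRetractions ρ)
    (hC : IsCGroup ρ) {α : Equiv.Perm (CosetElement (maximalParabolic ρ))}
    (hα : α ∈ (cosetGeometry (maximalParabolic ρ)).autI) {x : G} (hx : ∀ i, α (mk _ i x) = mk _ i x)
    (j i : ι) : α (mk _ i (ρ j * x)) = mk _ i (ρ j * x) := by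
  by_cases hij : j = i
  · subst hij
    have hinc : ∀ e ∈ cosetFlag (maximalParabolic ρ) {j}ᶜ x,
        (cosetGeometry _).Inc (α (mk _ j (ρ j * x))) e := by
      rintro _ ⟨k, hk, rfl⟩
      change (cosetGeometry _).Inc (α (mk _ j (ρ j * x))) (mk _ k x)
      rw [← hx k, hα.1]
      exact cosetGeometry_inc.2
        ⟨ρ j * x, rfl, mk_mul_of_mem (mem_maximalParabolic fun e => hk e.symm)⟩
    refine (h.eq_or_eq_of_forall_inc hC
      (hα.2 (mk _ j (ρ j * x))) hinc).resolve_left fun e => ?_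
    exact hC.mk_ne_mk j x (α.injective (e.trans (hx j).symm)).symm
  · rw [mk_mul_of_mem (mem_maximalParabolic hij)]
    exact hx i

/-- An automorphism that fixes a chamber fixes the adjacent chambers, hence everything. -/
lemma HasRetractions.eq_one_of_forall_apply [Finite ι] (h : HasRetractions ρ)
    (hC : IsCGroup ρ) {α : Equiv.Perm (CosetElement (maximalParabolic ρ))}
    (hα : α ∈ (cosetGeometry (maximalParabolic ρ)).autI) {x : G}
    (hx : ∀ i, α (mk _ i x) = mk _ i x) : α = 1 := by
  have hall (g : G) (hg : g ∈ parabolic ρ Set.univ) (i : ι) :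
      α (mk _ i (g * x)) = mk _ i (g * x) := by
    induction hg using Subgroup.closure_induction_left generalizing i with
    | one => simpa using hx i
    | mul_left g hg p hp ih =>
      obtain ⟨j, -, rfl⟩ := hg
      rw [mul_assoc]
      exact h.apply_mk_mul hC hα ih j i
    | inv_mul_cancel g hg p hp ih =>
      obtain ⟨j, -, rfl⟩ := hg
      rw [mul_assoc, inv_eq_of_mul_eq_one_left (hC.mul_self j)]
      exact h.apply_mk_mul hC hα ih j i
  refine Equiv.ext fun c => ?_
  obtain ⟨y, hy⟩ := exists_eq_mk c
  have := hall (y * x⁻¹) (hC.1 ▸ Subgroup.mem_top _) c.1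
  rw [inv_mul_cancel_right] at this
  rw [hy]
  exact this

lemma HasRetractions.isRegular [Finite ι] (h : HasRetractions ρ)
    (hC : IsCGroup ρ) : (cosetGeometry (maximalParabolic ρ)).IsRegular := by
  intro C C' hCh hCh'
  obtain ⟨α, hα, hαC⟩ := h.isFlagTransitive hC.1 C C' hCh.1 hCh'.1 (hCh.2.trans hCh'.2.symm)
  refine ⟨α, ⟨hα, hαC⟩, ?_⟩
  rintro β ⟨hβ, hβC⟩
  obtain ⟨x, rfl⟩ := h.exists_eq_chamber hC.1 hCh
  obtain ⟨y, rfl⟩ := h.exists_eq_chamber hC.1 hCh'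
  refine (inv_mul_eq_one.1 (h.eq_one_of_forall_apply hC (mul_mem (inv_mem hα) hβ) (x := x)
    fun i => ?_)).symm
  rw [Equiv.Perm.mul_apply, Equiv.Perm.inv_eq_iff_eq, apply_mk_of_image_eq hβ hβC,
    apply_mk_of_image_eq hα hαC]

lemma HasRetractions.exists_mulEquiv_autI [Finite ι] (h : HasRetractions ρ) (hC : IsCGroup ρ) :
    ∃ φ : G ≃* (cosetGeometry (maximalParabolic ρ)).autI, ∀ (g x : G) (i : ι),
      (φ g : Equiv.Perm (CosetElement (maximalParabolic ρ))) (mk _ i x) = mk _ i (x * g⁻¹) := by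
  let f : G →* (cosetGeometry (maximalParabolic ρ)).autI :=
    (cosetPerm _).codRestrict _ (cosetPerm_mem_autI _)
  refine ⟨MulEquiv.ofBijective f ⟨?_, ?_⟩, fun g x i => rfl⟩
  · rw [injective_iff_map_eq_one]
    intro g hg
    refine inv_eq_one.1 (hC.eq_one_of_forall_mem fun i => ?_)
    have h1 : cosetPerm (maximalParabolic ρ) g = 1 := congrArg Subtype.val hg
    have h2 := cosetPerm_mk (maximalParabolic ρ) g 1 i
    rw [h1, Equiv.Perm.one_apply, mk_eq_mk] at h2
    simpa using h2
  · rintro ⟨α, hα⟩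
    have hch : (cosetGeometry (maximalParabolic ρ)).IsChamber
        (α '' cosetFlag (maximalParabolic ρ) Set.univ 1) := by
      constructor
      · rintro _ ⟨a, ha, rfl⟩ _ ⟨b, hb, rfl⟩
        exact (hα.1 a b).2 (isFlag_cosetFlag _ _ a ha b hb)
      · refine Eq.trans ?_ (flagType_cosetFlag (H := maximalParabolic ρ) Set.univ 1)
        simp only [IncidenceSystem.flagType, Set.image_image, hα.2]
    obtain ⟨x, hx⟩ := h.exists_eq_chamber hC.1 hch
    refine ⟨x⁻¹, Subtype.ext ?_⟩
    refine inv_mul_eq_one.1 (h.eq_one_of_forall_apply hC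
      (mul_mem (inv_mem (cosetPerm_mem_autI _ x⁻¹)) hα) (x := 1) fun i => ?_)
    rw [Equiv.Perm.mul_apply, Equiv.Perm.inv_eq_iff_eq, apply_mk_of_image_eq hα hx]
    exact (congrArg (mk _ i) (by simp)).trans (cosetPerm_mk _ x⁻¹ 1 i).symm

/-! ### Rank two residues -/

section

variable [Finite ι] {i j k : ι}

lemma IsCGroup.residueMk_eq_residueMk (hC : IsCGroup ρ) (hjk : j ≠ k)
    (hi : ({i}ᶜ : Set ι) = {j, k}) {x : G} (hj : j ∈ ({i}ᶜ : Set ι)) {p q : parabolic ρ {i}ᶜ} :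
    residueMk x ⟨j, hj⟩ q = residueMk x ⟨j, hj⟩ p ↔ q = p ∨ (q : G) = ρ k * p := by
  rw [eq_comm, _root_.residueMk_eq_residueMk]
  constructor
  · rintro ⟨-, h⟩
    have : (q * p⁻¹ : G) = 1 ∨ (q * p⁻¹ : G) = ρ k := by
      refine hC.eq_one_or_eq fun o ho => ?_
      by_cases hoi : o = i
      · rw [hoi]
        exact mul_mem q.2 (inv_mem p.2)
      · have : o ∈ ({j, k} : Set ι) := hi ▸ hoi
        obtain rfl : o = j := this.resolve_right ho
        exact h
    exact this.imp (fun e => Subtype.ext (mul_inv_eq_one.1 e)) fun e => mul_inv_eq_iff_eq_mul.1 e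
  · rintro (rfl | h)
    · simp [one_mem]
    · simpa [h] using mem_maximalParabolic hjk.symm

/-- The residue of an element of type `i` in a rank three coset geometry, where `j` and `k` are the
other two types, is a polygon. Each element of type `j` or `k` of the residue corresponds to two
elements of the dihedral group generated by `ρ j` and `ρ k`. -/
lemma HasRetractions.residue_isPolygon (h : HasRetractions ρ) (hC : IsCGroup ρ)
    (hjk : j ≠ k) (hi : ({i}ᶜ : Set ι) = {j, k}) {p : ℕ}
    (hp : Nat.card (parabolic ρ {i}ᶜ) = 2 * p) (hp0 : p ≠ 0)
    {e : CosetElement (maximalParabolic ρ)} (he : e.1 = i) :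
    ((cosetGeometry (maximalParabolic ρ)).residue {e}).IsPolygon p := by
  obtain ⟨x, hx⟩ := exists_eq_mk e
  have hex : {e} = cosetFlag (maximalParabolic ρ) {i} x := by
    rw [cosetFlag, Set.image_singleton, ← he, ← hx]
  rw [hex]
  have hfin : Finite (parabolic ρ {i}ᶜ) := Nat.finite_of_card_ne_zero (by omega)
  have hother (o : ↥({i}ᶜ : Set ι)) :
      ∃ o' : ι, (o : ι) ≠ o' ∧ ({i}ᶜ : Set ι) = {(o : ι), o'} := by
    have : (o : ι) ∈ ({j, k} : Set ι) := hi ▸ o.2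
    rcases this with e | e
    · exact ⟨k, e ▸ hjk, e ▸ hi⟩
    · have e : (o : ι) = k := e
      exact ⟨j, e ▸ hjk.symm, hi.trans (by rw [e, Set.pair_comm])⟩
  refine ⟨h.residue_connected hC (hi ▸ Set.nontrivial_pair hjk) x, ?_, fun y => ?_⟩
  · have hcard : Nat.card (↥({i}ᶜ : Set ι)) = 2 := by
      rw [hi]
      exact Set.ncard_pair hjk
    let q : (↥({i}ᶜ : Set ι)) × parabolic ρ {i}ᶜ →
      (cosetGeometry (maximalParabolic ρ)).ResidueElement
        (cosetFlag (maximalParabolic ρ) {i} x) := fun y => residueMk x y.1 y.2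
    have hq : Function.Surjective q := fun y => by
      obtain ⟨k, p, rfl⟩ := h.exists_eq_residueMk hC y
      exact ⟨(k, p), rfl⟩
    have := Finite.of_surjective q hq
    have hfib (y) : Nat.card {a // q a = y} = 2 := by
      obtain ⟨⟨o, g⟩, rfl⟩ := hq y
      obtain ⟨o', hne, hi'⟩ := hother o
      have ho' : ρ o' ∈ parabolic ρ {i}ᶜ := mem_parabolic (by rw [hi']; simp)
      have heq : {a | q a = q (o, g)} = {(o, g), (o, ⟨ρ o', ho'⟩ * g)} := by
        ext ⟨o'', g'⟩
        simp only [Set.mem_ofPred_eq, Set.mem_insert_iff, Prod.mk.injEq, Set.mem_singleton_iff,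
          ← and_or_left]
        constructor
        · intro hg
          obtain rfl : o'' = o := (_root_.residueMk_eq_residueMk.1 hg).1
          exact ⟨rfl, ((hC.residueMk_eq_residueMk hne hi' o''.2).1 hg).imp id
            fun e => Subtype.ext e⟩
        · rintro ⟨rfl, hg⟩
          exact (hC.residueMk_eq_residueMk hne hi' o''.2).2 (hg.imp id (congrArg Subtype.val))
      change Nat.card {a | q a = q (o, g)} = 2
      rw [heq]
      refine Set.ncard_pair fun e => ?_
      have e1 : (g : G) = ρ o' * g := congrArg (fun a => (a.2 : G)) e
      have e2 := hC.2.1 o'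
      rw [right_eq_mul.1 e1] at e2
      simp at e2
    have hsum := Nat.card_congr (Equiv.sigmaFiberEquiv q)
    have := Fintype.ofFinite ((cosetGeometry (maximalParabolic ρ)).ResidueElement
        (cosetFlag (maximalParabolic ρ) {i} x))
    rw [Nat.card_sigma, Finset.sum_congr rfl fun y _ => hfib y, Nat.card_prod, hcard, hp,
      Finset.sum_const, Finset.card_univ, ← Nat.card_eq_fintype_card, smul_eq_mul] at hsum
    omega
  · obtain ⟨o, g, rfl⟩ := h.exists_eq_residueMk hC y
    obtain ⟨o', hne, hi'⟩ := hother o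
    have hmem : o' ∈ ({i}ᶜ : Set ι) := by rw [hi']; simp
    have ho' : ρ o' ∈ parabolic ρ {i}ᶜ := mem_parabolic hmem
    have hgo : ((cosetGeometry (maximalParabolic ρ)).residue
        (cosetFlag (maximalParabolic ρ) {i} x)).incidenceGraph.neighborSet (residueMk x o g) =
        {residueMk x ⟨o', hmem⟩ g, residueMk x ⟨o', hmem⟩ (⟨ρ o', ho'⟩ * g)} := by
      refine Set.Subset.antisymm ?_ ?_
      · intro z hz
        obtain ⟨o'', g', rfl⟩ := h.exists_eq_residueMk hC z
        obtain ⟨hz1, hz2⟩ := hz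
        have hoo : o'' ≠ o := by
          rintro rfl
          exact hz1 (((cosetGeometry (maximalParabolic ρ)).residue _).eq_of_type_eq _ _ hz2 rfl)
        obtain rfl : o'' = ⟨o', hmem⟩ := by
          have : (o'' : ι) ∈ ({(o : ι), o'} : Set ι) := hi' ▸ o''.2
          exact Subtype.ext (this.resolve_left fun e => hoo (Subtype.ext e))
        have hinc : ∀ e ∈ cosetFlag (maximalParabolic ρ) {o'}ᶜ (g * x),
            (cosetGeometry _).Inc (mk _ o' (g' * x)) e := by
          rintro _ ⟨u, hu, rfl⟩
          by_cases hui : u = i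
          · subst hui
            refine cosetGeometry_inc.2 ⟨g' * x, rfl, ?_⟩
            rw [mk_mul_of_mem (H := maximalParabolic ρ) g.2,
              mk_mul_of_mem (H := maximalParabolic ρ) g'.2]
          · have : u ∈ ({(o : ι), o'} : Set ι) := hi' ▸ hui
            obtain rfl : u = o := this.resolve_right hu
            exact (cosetGeometry _).symm _ _ hz2
        rcases h.eq_or_eq_of_forall_inc hC
            (rfl : (mk (maximalParabolic ρ) o' (g' * x)).1 = o') hinc with e | e
        · exact Or.inl (Subtype.ext e)
        · exact Or.inr (Subtype.ext (e.trans (by rw [← mul_assoc]; rfl)))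
      · have hne' : o ≠ ⟨o', hmem⟩ := fun e => hne (congrArg Subtype.val e)
        rintro z (rfl | rfl)
        · exact ⟨fun e => hne' (_root_.residueMk_eq_residueMk.1 e).1,
            cosetGeometry_inc.2 ⟨g * x, rfl, rfl⟩⟩
        · refine ⟨fun e => hne' (_root_.residueMk_eq_residueMk.1 e).1,
            cosetGeometry_inc.2 ⟨ρ o' * (g * x), mk_mul_of_mem (mem_maximalParabolic hne.symm), ?_⟩⟩
          rw [← mul_assoc]
          rfl
    rw [hgo]
    refine Set.ncard_pair fun e => hC.mk_ne_mk o' (g * x) ((congrArg Subtype.val e).trans ?_)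
    rw [← mul_assoc]
    rfl

end

end Automorphisms

/-! ### Homomorphisms out of cyclic and dihedral groups -/

section CyclicDihedral

variable {H : Type*} [Group H]

/-- The homomorphism from the cyclic group of order `k` that maps the generator to `x`. -/
def cycLift {k : ℕ} {x : H} (hx : x ^ k = 1) : Cyc k →* H :=
  AddMonoidHom.toMultiplicativeLeft (ZMod.lift k
    ⟨zmultiplesHom (Additive H) (Additive.ofMul x), by
      rw [zmultiplesHom_apply, natCast_zsmul, ← ofMul_pow, hx, ofMul_one]⟩)

lemma cycLift_intCast {k : ℕ} {x : H} (hx : x ^ k = 1) (i : ℤ) :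
    cycLift hx (Multiplicative.ofAdd (i : ZMod k)) = x ^ i := by
  change (ZMod.lift k _ (i : ZMod k) : Additive H).toMul = _
  rw [ZMod.lift_coe]
  rfl

lemma cycLift_one {k : ℕ} {x : H} (hx : x ^ k = 1) :
    cycLift hx (Multiplicative.ofAdd 1) = x := by
  simpa using cycLift_intCast hx 1

lemma Cyc.exists_eq {k : ℕ} (u : Cyc k) : ∃ i : ℤ, u = Multiplicative.ofAdd (i : ZMod k) := by
  obtain ⟨i, hi⟩ := ZMod.intCast_surjective u.toAdd
  exact ⟨i, by rw [hi]; rfl⟩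

lemma cycLift_inv {k : ℕ} {x : H} (hx : x ^ k = 1) {g : H} (h : SemiconjBy g x x⁻¹) (u : Cyc k) :
    SemiconjBy g (cycLift hx u) (cycLift hx u⁻¹) := by
  obtain ⟨i, rfl⟩ := u.exists_eq
  rw [map_inv, cycLift_intCast, ← inv_zpow]
  exact h.zpow_right i

lemma cycLift_self {k : ℕ} {x : H} (hx : x ^ k = 1) {g : H} (h : Commute g x) (u : Cyc k) :
    Commute g (cycLift hx u) := by
  obtain ⟨i, rfl⟩ := u.exists_eq
  rw [cycLift_intCast]
  exact h.zpow_right i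

lemma cycLift_commute {k k' : ℕ} {x x' : H} (hx : x ^ k = 1) (hx' : x' ^ k' = 1)
    (h : Commute x x') (u : Cyc k) (u' : Cyc k') : Commute (cycLift hx u) (cycLift hx' u') :=
  cycLift_self hx' (cycLift_self hx h.symm u).symm u'

lemma inv_eq_self_of_mul_self {x : H} (hx : x * x = 1) : x⁻¹ = x :=
  inv_eq_of_mul_eq_one_left hx

lemma commute_of_mul_sq {x y : H} (hx : x * x = 1) (hy : y * y = 1) (h : (x * y) ^ 2 = 1) :
    Commute x y := by
  have h1 : x * y * (x * y) = 1 := by rwa [sq] at h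
  have h2 := inv_eq_self_of_mul_self h1
  rw [mul_inv_rev, inv_eq_self_of_mul_self hx, inv_eq_self_of_mul_self hy] at h2
  exact h2.symm

lemma semiconjBy_mul_inv {x y : H} (hx : x * x = 1) (hy : y * y = 1) :
    SemiconjBy x (x * y) (x * y)⁻¹ := by
  rw [SemiconjBy, mul_inv_rev, inv_eq_self_of_mul_self hx, inv_eq_self_of_mul_self hy,
    ← mul_assoc, hx, mul_assoc, hx, one_mul, mul_one]

lemma semiconjBy_mul_inv' {x y : H} (hx : x * x = 1) (hy : y * y = 1) :
    SemiconjBy y (x * y) (x * y)⁻¹ := by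
  rw [SemiconjBy, mul_inv_rev, inv_eq_self_of_mul_self hx, inv_eq_self_of_mul_self hy, mul_assoc]

namespace DihedralGroup

variable {k : ℕ}

/-- The homomorphism from the dihedral group that maps the generating reflections `sr 0` and
`sr 1` to the involutions `x` and `y`. -/
def lift {x y : H} (hx : x * x = 1) (hy : y * y = 1) (hxy : (x * y) ^ k = 1) :
    DihedralGroup k →* H where
  toFun
    | r i => cycLift hxy (Multiplicative.ofAdd i)
    | sr i => x * cycLift hxy (Multiplicative.ofAdd i)
  map_one' := map_one (cycLift hxy)
  map_mul' := by
    have h (u : ZMod k) := cycLift_inv hxy (semiconjBy_mul_inv hx hy) (Multiplicative.ofAdd u)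
    have h' (u v : ZMod k) : x * cycLift hxy (Multiplicative.ofAdd (u - v)) =
        cycLift hxy (Multiplicative.ofAdd v) * (x * cycLift hxy (Multiplicative.ofAdd u)) := by
      have h1 := (h (-v)).eq
      rw [← ofAdd_neg, neg_neg] at h1
      rw [← mul_assoc, ← h1, mul_assoc, ← map_mul, ← ofAdd_add, neg_add_eq_sub]
    rintro (i | i) (j | j)
    · rw [r_mul_r]
      exact map_mul (cycLift hxy) (Multiplicative.ofAdd i) (Multiplicative.ofAdd j)
    · rw [r_mul_sr]
      exact h' j i
    · rw [sr_mul_r]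
      change x * cycLift hxy (Multiplicative.ofAdd i * Multiplicative.ofAdd j) = _
      rw [map_mul, mul_assoc]
    · rw [sr_mul_sr]
      change cycLift hxy (Multiplicative.ofAdd (j - i)) = x * _ * (x * _)
      rw [mul_assoc, ← h', ← mul_assoc, hx, one_mul]

lemma lift_sr_zero {x y : H} (hx : x * x = 1) (hy : y * y = 1) (hxy : (x * y) ^ k = 1) :
    lift hx hy hxy (sr 0) = x := by
  change x * cycLift hxy 1 = x
  rw [map_one, mul_one]

lemma lift_sr_one {x y : H} (hx : x * x = 1) (hy : y * y = 1) (hxy : (x * y) ^ k = 1) :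
    lift hx hy hxy (sr 1) = y := by
  change x * cycLift hxy (Multiplicative.ofAdd 1) = y
  rw [cycLift_one, ← mul_assoc, hx, one_mul]

/-- The dihedral group is generated by `sr 0` and `sr 1`. -/
lemma eq_top_of_mem {S : Subgroup (DihedralGroup k)} (h0 : sr 0 ∈ S) (h1 : sr 1 ∈ S) : S = ⊤ := by
  have hr (i : ZMod k) : r i ∈ S := by
    obtain ⟨i, rfl⟩ := ZMod.intCast_surjective i
    have : (r 1 : DihedralGroup k) ∈ S := by simpa using mul_mem h0 h1
    simpa using zpow_mem this i
  rw [eq_top_iff]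
  rintro (i | i) -
  · exact hr i
  · simpa using mul_mem h0 (hr i)

lemma hom_ext' {f g : DihedralGroup k →* H} (h0 : f (sr 0) = g (sr 0)) (h1 : f (sr 1) = g (sr 1)) :
    f = g := by
  have : f.eqLocus g = ⊤ := eq_top_of_mem h0 h1
  exact MonoidHom.ext fun x => show x ∈ f.eqLocus g from this ▸ Subgroup.mem_top x

lemma commute_of_commute {k' : ℕ} {f : DihedralGroup k →* H} {g : DihedralGroup k' →* H}
    (h00 : Commute (f (sr 0)) (g (sr 0))) (h01 : Commute (f (sr 0)) (g (sr 1)))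
    (h10 : Commute (f (sr 1)) (g (sr 0))) (h11 : Commute (f (sr 1)) (g (sr 1)))
    (u : DihedralGroup k) (v : DihedralGroup k') : Commute (f u) (g v) := by
  have key {y : H} (h0 : Commute y (g (sr 0))) (h1 : Commute y (g (sr 1)))
      (v : DihedralGroup k') : Commute y (g v) := by
    have : (Subgroup.centralizer {y}).comap g = ⊤ :=
      eq_top_of_mem (Subgroup.mem_centralizer_singleton_iff.2 h0.symm)
        (Subgroup.mem_centralizer_singleton_iff.2 h1.symm)
    have hv : v ∈ (Subgroup.centralizer {y}).comap g := this ▸ Subgroup.mem_top v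
    exact Commute.symm (Subgroup.mem_centralizer_singleton_iff.1 hv)
  have : (Subgroup.centralizer {g v}).comap f = ⊤ :=
    eq_top_of_mem (Subgroup.mem_centralizer_singleton_iff.2 (key h00 h01 v))
      (Subgroup.mem_centralizer_singleton_iff.2 (key h10 h11 v))
  have hu : u ∈ (Subgroup.centralizer {g v}).comap f := this ▸ Subgroup.mem_top u
  exact Subgroup.mem_centralizer_singleton_iff.1 hu

lemma sr_one_mul_sr_zero_pow : (sr 1 * sr 0 : DihedralGroup k) ^ k = 1 := by
  rw [sr_mul_sr, zero_sub, ← inv_r, inv_pow, r_one_pow_n, inv_one]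

lemma lift_comp_lift_swap :
    (lift (k := k) (sr_mul_self 1) (sr_mul_self 0) sr_one_mul_sr_zero_pow).comp
      (lift (sr_mul_self 1) (sr_mul_self 0) sr_one_mul_sr_zero_pow) = MonoidHom.id _ := by
  refine hom_ext' ?_ ?_ <;> simp [lift_sr_zero, lift_sr_one]

/-- The automorphism that exchanges `sr 0` and `sr 1`. -/
def exchange : MulAut (DihedralGroup k) :=
  MonoidHom.toMulEquiv _ _ lift_comp_lift_swap lift_comp_lift_swap

lemma exchange_sr_zero : exchange (sr 0 : DihedralGroup k) = sr 1 :=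
  lift_sr_zero (sr_mul_self 1) (sr_mul_self 0) sr_one_mul_sr_zero_pow

lemma exchange_sr_one : exchange (sr 1 : DihedralGroup k) = sr 0 :=
  lift_sr_one (sr_mul_self 1) (sr_mul_self 0) sr_one_mul_sr_zero_pow

lemma exchange_mul_exchange : (exchange : MulAut (DihedralGroup k)) * exchange = 1 :=
  MulEquiv.toMonoidHom_injective (hom_ext'
    ((congrArg exchange exchange_sr_zero).trans exchange_sr_one)
    ((congrArg exchange exchange_sr_one).trans exchange_sr_zero))

end DihedralGroup

end CyclicDihedral

/-! ### Quotients of the Coxeter group of type `{4, 4}` -/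

section Toroidal

/-- The relations of the Coxeter group of type `{4, 4}`, the symmetry group of the square
tessellation of the plane. -/
structure IsToroidal {H : Type*} [Group H] (a b c : H) : Prop where
  sq_a : a * a = 1
  sq_b : b * b = 1
  sq_c : c * c = 1
  ab : (a * b) ^ 4 = 1
  bc : (b * c) ^ 4 = 1
  ac : (a * c) ^ 2 = 1

variable {H : Type*} [Group H]

lemma conj_mul_self {x y : H} (hx : x * x = 1) (hy : y * y = 1) : x * y * x * (x * y * x) = 1 := by
  rw [show x * y * x * (x * y * x) = x * y * (x * x) * (y * x) by
    simp only [mul_assoc], hx, mul_one,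
    show x * y * (y * x) = x * (y * y) * x by simp only [mul_assoc], hy, mul_one, hx]

theorem Commute.conj_of_mul_self {g x y : H} (hg : g * g = 1)
    (h : Commute x y) :
    Commute (g * x * g) (g * y * g) := by
  have h1 (u v : H) : g * u * g * (g * v * g) = g * (u * v) * g := by
    rw [show g * u * g * (g * v * g) = g * u * (g * g) * v * g by
      simp only [mul_assoc], hg, mul_one,
      mul_assoc g u v]
  rw [Commute, SemiconjBy, h1, h1, h.eq]

lemma conj_pow_of_mul_self {g x : H} (hg : g * g = 1) (n : ℕ) :
    (g * x * g) ^ n = g * x ^ n * g := by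
  have h1 := conj_pow (i := n) (a := g) (b := x)
  rwa [inv_eq_self_of_mul_self hg] at h1

namespace IsToroidal

variable {a b c : H}

lemma commute_ac (h : IsToroidal a b c) : Commute a c := commute_of_mul_sq h.sq_a h.sq_c h.ac

lemma commute_a_bab (h : IsToroidal a b c) : Commute a (b * a * b) := by
  refine commute_of_mul_sq h.sq_a (conj_mul_self h.sq_b h.sq_a) ?_
  rw [show a * (b * a * b) = (a * b) ^ 2 by
    simp only [pow_succ, pow_zero, one_mul, mul_assoc], ← pow_mul]
  exact h.ab

lemma commute_b_aba (h : IsToroidal a b c) : Commute b (a * b * a) := by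
  refine commute_of_mul_sq h.sq_b (conj_mul_self h.sq_a h.sq_b) ?_
  have h1 : (b * a) ^ 4 = 1 := by
    rw [← inv_eq_one, ← inv_pow, mul_inv_rev, inv_eq_self_of_mul_self h.sq_a,
      inv_eq_self_of_mul_self h.sq_b, h.ab]
  rw [show b * (a * b * a) = (b * a) ^ 2 by
    simp only [pow_succ, pow_zero, one_mul, mul_assoc], ← pow_mul]
  exact h1

lemma symm (h : IsToroidal a b c) : IsToroidal c b a where
  sq_a := h.sq_c
  sq_b := h.sq_b
  sq_c := h.sq_a
  ab := by
    rw [← inv_eq_one, ← inv_pow, mul_inv_rev, inv_eq_self_of_mul_self h.sq_c,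
      inv_eq_self_of_mul_self h.sq_b, h.bc]
  bc := by
    rw [← inv_eq_one, ← inv_pow, mul_inv_rev, inv_eq_self_of_mul_self h.sq_a,
      inv_eq_self_of_mul_self h.sq_b, h.ab]
  ac := by rw [← h.commute_ac.eq, h.ac]

/-- The commutator in the relator for even `m` is the square of the translation `b a b c`. -/
lemma comm'_sq_c (h : IsToroidal a b c) : comm' ((a * b) ^ 2) c = (b * a * b * c) ^ 2 := by
  have h1 : (a * b) ^ 2 = a * (b * a * b) := by simp only [pow_succ, pow_zero, one_mul, mul_assoc]
  have h2 : ((a * b) ^ 2)⁻¹ = b * a * b * a := by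
    rw [h1, mul_inv_rev, inv_eq_self_of_mul_self h.sq_a,
      inv_eq_self_of_mul_self (conj_mul_self h.sq_b h.sq_a)]
  rw [comm', h2, inv_eq_self_of_mul_self h.sq_c, h1]
  rw [show b * a * b * a * c * (a * (b * a * b)) * c =
    b * a * b * (a * c * a) * (b * a * b) * c by simp only [mul_assoc],
    h.commute_ac.eq, mul_assoc c a a, h.sq_a]
  simp only [pow_succ, pow_zero, one_mul, mul_assoc]

/-- The commutator in the relator for odd `m` is the square of the product of two parallel
reflections. -/
lemma comm'_sq_sq (h : IsToroidal a b c) :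
    comm' ((a * b) ^ 2) ((b * c) ^ 2) = (a * b * a * (c * b * c)) ^ 2 := by
  have h1 : (a * b) ^ 2 = a * b * a * b := by simp only [pow_succ, pow_zero, one_mul, mul_assoc]
  have h1' : ((a * b) ^ 2)⁻¹ = a * b * a * b := by
    rw [h1, mul_inv_rev, inv_eq_self_of_mul_self h.sq_b,
      inv_eq_self_of_mul_self (conj_mul_self h.sq_a h.sq_b), h.commute_b_aba.eq]
  have h2 : (b * c) ^ 2 = b * (c * b * c) := by simp only [pow_succ, pow_zero, one_mul, mul_assoc]
  have h2' : ((b * c) ^ 2)⁻¹ = c * b * c * b := by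
    rw [h2, mul_inv_rev, inv_eq_self_of_mul_self h.sq_b,
      inv_eq_self_of_mul_self (conj_mul_self h.sq_c h.sq_b)]
  rw [comm', h1', h2', h1, h2]
  rw [show a * b * a * b * (c * b * c * b) * (a * b * a * b) * (b * (c * b * c)) =
    a * b * a * (b * (c * b * c)) * (b * (a * b * a)) * (b * b) * (c * b * c) by
      simp only [mul_assoc], h.sq_b,
    h.symm.commute_b_aba.eq, mul_one,
    show a * b * a * (c * b * c * b) * (b * (a * b * a)) * (c * b * c) =
    a * b * a * (c * b * c) * (b * b) * (a * b * a) * (c * b * c) by simp only [mul_assoc], h.sq_b]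
  simp only [pow_succ, pow_zero, one_mul, mul_assoc]

lemma commute_bab_bcb (h : IsToroidal a b c) : Commute (b * a * b) (b * c * b) :=
  h.commute_ac.conj_of_mul_self h.sq_b

end IsToroidal

/-! ### The model for even `m` -/

open DihedralGroup (sr lift_sr_zero lift_sr_one)
open SemidirectProduct (inl inr lift_inl lift_inr mk_eq_inl_mul_inr inl_aut)

/-- The cyclic group of order two that exchanges the two factors. -/
def swapAction (N : Type*) [Group N] : Cyc 2 →* MulAut (N × N) :=
  cycLift (k := 2) (x := (MulEquiv.prodComm : N × N ≃* N × N)) (by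
    rw [sq]
    rfl)

lemma swapAction_one {N : Type*} [Group N] (p : N × N) :
    swapAction N (Multiplicative.ofAdd 1) p = p.swap := by
  rw [swapAction, cycLift_one]
  rfl

lemma inl_mk_one_one {N M Q : Type*} [Group N] [Group M] [Group Q] {φ : Q →* MulAut (N × M)} :
    (inl (1, 1) : (N × M) ⋊[φ] Q) = 1 := map_one inl

lemma Cyc.eq_one_or_eq (u : Cyc 2) : u = 1 ∨ u = Multiplicative.ofAdd 1 := by
  revert u
  decide

/-- The symmetry group of the square tessellation modulo the translations by `k` along the axes.
The dihedral groups act on the two coordinates: `sr j` is the reflection `x ↦ j - x`. -/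
abbrev EvenModel (k : ℕ) : Type :=
  (DihedralGroup k × DihedralGroup k) ⋊[swapAction (DihedralGroup k)] Cyc 2

namespace EvenModel

variable {k : ℕ}

/-- The reflection `y ↦ -y`. -/
def a : EvenModel k := inl (1, sr 0)

/-- The reflection that exchanges the coordinates. -/
def b : EvenModel k := inr (Multiplicative.ofAdd 1)

/-- The reflection `x ↦ 1 - x`. -/
def c : EvenModel k := inl (sr 1, 1)

lemma b_mul_b : (b : EvenModel k) * b = 1 := by
  rw [b, ← map_mul, show (Multiplicative.ofAdd 1 * Multiplicative.ofAdd 1 : Cyc 2) = 1 by decide,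
    map_one]

lemma b_mul_inl_mul_b (p : DihedralGroup k × DihedralGroup k) :
    (b : EvenModel k) * inl p * b = inl p.swap := by
  have := inl_aut (φ := swapAction (DihedralGroup k)) (Multiplicative.ofAdd 1) p
  rw [swapAction_one, map_inv, ← b, inv_eq_self_of_mul_self b_mul_b] at this
  exact this.symm

lemma isToroidal : IsToroidal (a : EvenModel k) b c where
  sq_a := by simp [a, ← map_mul, inl_mk_one_one]
  sq_b := b_mul_b
  sq_c := by simp [c, ← map_mul, inl_mk_one_one]
  ab := by
    rw [show ((a : EvenModel k) * b) ^ 4 = (a * (b * a * b)) ^ 2 by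
      simp only [pow_succ, pow_zero, one_mul, mul_assoc], a, b_mul_inl_mul_b,
      ← map_mul, ← map_pow]
    simp [sq, inl_mk_one_one]
  bc := by
    rw [show ((b : EvenModel k) * c) ^ 4 = (b * c * b * c) ^ 2 by
      simp only [pow_succ, pow_zero, one_mul, mul_assoc], c, b_mul_inl_mul_b,
      ← map_mul, ← map_pow]
    simp [sq, inl_mk_one_one]
  ac := by
    rw [a, c, ← map_mul, ← map_pow]
    simp [sq, inl_mk_one_one]

lemma bab_mul_c_pow : ((b : EvenModel k) * a * b * c) ^ k = 1 := by
  rw [a, c, b_mul_inl_mul_b, ← map_mul, ← map_pow]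
  simp [inl_mk_one_one]

lemma eq_top_of_mem {S : Subgroup (EvenModel k)} (ha : a ∈ S) (hb : b ∈ S) (hc : c ∈ S) :
    S = ⊤ := by
  have h1 : S.comap (inl.comp (MonoidHom.inl _ _)) = ⊤ := by
    refine DihedralGroup.eq_top_of_mem ?_ hc
    have := b_mul_inl_mul_b (k := k) (1, sr 0)
    exact (this ▸ mul_mem (mul_mem hb ha) hb : inl (1, sr 0).swap ∈ S)
  have h2 : S.comap (inl.comp (MonoidHom.inr _ _)) = ⊤ := by
    refine DihedralGroup.eq_top_of_mem ha ?_
    have := b_mul_inl_mul_b (k := k) (sr 1, 1)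
    exact (this ▸ mul_mem (mul_mem hb hc) hb : inl (sr 1, 1).swap ∈ S)
  rw [eq_top_iff]
  rintro ⟨⟨u, v⟩, w⟩ -
  have hu : inl (u, 1) ∈ S := (h1 ▸ Subgroup.mem_top u :)
  have hv : inl (1, v) ∈ S := (h2 ▸ Subgroup.mem_top v :)
  rw [mk_eq_inl_mul_inr]
  refine mul_mem ?_ ?_
  · simpa [← map_mul] using mul_mem hu hv
  · rcases w.eq_one_or_eq with rfl | rfl
    · simp [one_mem]
    · exact hb

/-- The model has the presentation of the toroidal map of type `{4, 4}` with `k ^ 2` vertices. -/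
lemma exists_hom {a' b' c' : H} (h : IsToroidal a' b' c') (hk : (b' * a' * b' * c') ^ k = 1) :
    ∃ g : EvenModel k →* H, g a = a' ∧ g b = b' ∧ g c = c' := by
  have hbab := conj_mul_self h.sq_b h.sq_a
  have hbcb := conj_mul_self h.sq_b h.sq_c
  have hb : b' ^ 2 = 1 := by rw [sq, h.sq_b]
  have hk' : (a' * (b' * c' * b')) ^ k = 1 := by
    rw [show a' * (b' * c' * b') = b'⁻¹ * (b' * a' * b' * c') * b' by group,
      inv_eq_self_of_mul_self h.sq_b, conj_pow_of_mul_self h.sq_b, hk, mul_one, h.sq_b]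
  let f₁ := DihedralGroup.lift hbab h.sq_c hk
  let f₂ := DihedralGroup.lift h.sq_a hbcb hk'
  have e10 : f₁ (sr 0) = b' * a' * b' := lift_sr_zero _ _ _
  have e11 : f₁ (sr 1) = c' := lift_sr_one _ _ _
  have e20 : f₂ (sr 0) = a' := lift_sr_zero _ _ _
  have e21 : f₂ (sr 1) = b' * c' * b' := lift_sr_one _ _ _
  have hcomm (u v : DihedralGroup k) : Commute (f₁ u) (f₂ v) :=
    DihedralGroup.commute_of_commute (by rw [e10, e20]; exact h.commute_a_bab.symm)
      (by rw [e10, e21]; exact h.commute_bab_bcb)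
      (by rw [e11, e20]; exact h.commute_ac.symm)
      (by rw [e11, e21]; exact h.symm.commute_a_bab) u v
  let f := f₁.noncommCoprod f₂ hcomm
  have hconj (x : H) : b' * (b' * x * b') * b' = x := by
    rw [show b' * (b' * x * b') * b' = b' * b' * x * (b' * b') by
      simp only [mul_assoc], h.sq_b, one_mul, mul_one]
  -- conjugation by `b'` exchanges the two dihedral groups
  have h12 (u : DihedralGroup k) : f₂ u = b' * f₁ u * b' := by
    have : f₂ = ((MulAut.conj b').toMonoidHom).comp f₁ := DihedralGroup.hom_ext'
      (by simp [e20, e10, inv_eq_self_of_mul_self h.sq_b, hconj])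
      (by simp [e21, e11, inv_eq_self_of_mul_self h.sq_b])
    rw [this]
    simp [inv_eq_self_of_mul_self h.sq_b]
  have hcompat (w : Cyc 2) : f.comp (swapAction (DihedralGroup k) w).toMonoidHom =
      (MulAut.conj (cycLift hb w)).toMonoidHom.comp f := by
    rcases w.eq_one_or_eq with rfl | rfl
    · exact MonoidHom.ext fun p => by simp
    · refine MonoidHom.ext fun p => ?_
      obtain ⟨u, v⟩ := p
      have h1 : f (u, v) = f₁ u * f₂ v := rfl
      have h2 : f (v, u) = f₁ v * f₂ u := rfl
      have h3 : f (swapAction _ (Multiplicative.ofAdd 1) (u, v)) = b' * f (u, v) * b'⁻¹ := by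
        rw [swapAction_one, Prod.swap_prod_mk, h1, h2, (hcomm v u).eq, h12 u, h12 v,
          inv_eq_self_of_mul_self h.sq_b]
        rw [show b' * (f₁ u * (b' * f₁ v * b')) * b' = b' * f₁ u * b' * f₁ v * (b' * b') by
          simp only [mul_assoc],
          h.sq_b, mul_one]
      simpa [cycLift_one] using h3
  refine ⟨SemidirectProduct.lift f (cycLift hb) hcompat, ?_, ?_, ?_⟩
  · rw [a, lift_inl]
    simp [f, e20]
  · rw [b, lift_inr, cycLift_one]
  · rw [c, lift_inl]
    simp [f, e11]

end EvenModel

end Toroidal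

/-! ### The model for odd `m` -/

section OddModel

open DihedralGroup (sr lift_sr_zero lift_sr_one exchange exchange_sr_zero exchange_sr_one
  exchange_mul_exchange)
open SemidirectProduct (inl inr lift_inl lift_inr mk_eq_inl_mul_inr inl_aut)

variable {H : Type*} [Group H]

/-- The automorphism `(u, v) ↦ (exchange v, exchange u)`. -/
def exchangeSwap (k : ℕ) : MulAut (DihedralGroup k × DihedralGroup k) :=
  (MulEquiv.prodComm : DihedralGroup k × DihedralGroup k ≃* _).trans
    (MulEquiv.prodCongr exchange exchange)

lemma exchangeSwap_apply {k : ℕ} (u v : DihedralGroup k) :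
    exchangeSwap k (u, v) = (exchange v, exchange u) := rfl

lemma exchange_exchange {k : ℕ} (u : DihedralGroup k) : exchange (exchange u) = u :=
  congrArg (fun e : MulAut (DihedralGroup k) => e u) exchange_mul_exchange

lemma exchangeSwap_sq (k : ℕ) : exchangeSwap k ^ 2 = 1 := by
  rw [sq]
  refine MulEquiv.ext fun ⟨u, v⟩ => ?_
  rw [MulAut.mul_apply, exchangeSwap_apply, exchangeSwap_apply, exchange_exchange,
    exchange_exchange]
  rfl

lemma commute_swapAction (k : ℕ) (u v : Cyc 2) :
    Commute (swapAction (DihedralGroup k) u) (cycLift (exchangeSwap_sq k) v) :=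
  cycLift_commute _ _ (by
    rw [Commute, SemiconjBy]
    rfl) u v

/-- The Klein four-group acting by the swap of the factors, and by the swap
composed with `exchange` on both factors. -/
def swapExchangeAction (k : ℕ) : Cyc 2 × Cyc 2 →* MulAut (DihedralGroup k × DihedralGroup k) :=
  (swapAction (DihedralGroup k)).noncommCoprod (cycLift (exchangeSwap_sq k))
    (commute_swapAction k)

lemma swapExchangeAction_one_left {k : ℕ} (p : DihedralGroup k × DihedralGroup k) :
    swapExchangeAction k (Multiplicative.ofAdd 1, 1) p = p.swap := by
  refine Eq.trans ?_ (swapAction_one p)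
  rw [swapExchangeAction, MonoidHom.noncommCoprod_apply, map_one (cycLift _), mul_one]

lemma swapExchangeAction_one_right {k : ℕ} (u v : DihedralGroup k) :
    swapExchangeAction k (1, Multiplicative.ofAdd 1) (u, v) = (exchange v, exchange u) := by
  rw [← exchangeSwap_apply, swapExchangeAction, MonoidHom.noncommCoprod_apply,
    map_one (swapAction _), one_mul, cycLift_one]

/-- The symmetry group of the square tessellation modulo the translations by `(k, k)` and
`(k, -k)`. The dihedral groups consist of the translations along the diagonals and of the
reflections in lines parallel to the diagonals. -/
abbrev OddModel (k : ℕ) : Type :=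
  (DihedralGroup k × DihedralGroup k) ⋊[swapExchangeAction k] (Cyc 2 × Cyc 2)

namespace OddModel

variable {k : ℕ}

/-- The reflection `y ↦ -y`. -/
def a : OddModel k := inr (Multiplicative.ofAdd 1, 1)

/-- The reflection that exchanges the coordinates. -/
def b : OddModel k := inl (sr 0, 1)

/-- The reflection `x ↦ 1 - x`. -/
def c : OddModel k := inr (1, Multiplicative.ofAdd 1)

lemma a_mul_a : (a : OddModel k) * a = 1 := by
  rw [a, ← map_mul, show ((Multiplicative.ofAdd 1, 1) * (Multiplicative.ofAdd 1, 1) :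
    Cyc 2 × Cyc 2) = 1 by decide, map_one]

lemma c_mul_c : (c : OddModel k) * c = 1 := by
  rw [c, ← map_mul, show ((1, Multiplicative.ofAdd 1) * (1, Multiplicative.ofAdd 1) :
    Cyc 2 × Cyc 2) = 1 by decide, map_one]

lemma a_mul_inl_mul_a (u v : DihedralGroup k) :
    (a : OddModel k) * inl (u, v) * a = inl (v, u) := by
  have := inl_aut (φ := swapExchangeAction k) (Multiplicative.ofAdd 1, 1) (u, v)
  rw [swapExchangeAction_one_left, map_inv, ← a, inv_eq_self_of_mul_self a_mul_a] at this
  exact this.symm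

lemma c_mul_inl_mul_c (u v : DihedralGroup k) :
    (c : OddModel k) * inl (u, v) * c = inl (exchange v, exchange u) := by
  have := inl_aut (φ := swapExchangeAction k) (1, Multiplicative.ofAdd 1) (u, v)
  rw [swapExchangeAction_one_right, map_inv, ← c, inv_eq_self_of_mul_self c_mul_c] at this
  exact this.symm

lemma isToroidal : IsToroidal (a : OddModel k) b c where
  sq_a := a_mul_a
  sq_b := by simp [b, ← map_mul, inl_mk_one_one]
  sq_c := c_mul_c
  ab := by
    rw [show ((a : OddModel k) * b) ^ 4 = (a * b * a * b) ^ 2 by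
      simp only [pow_succ, pow_zero, one_mul, mul_assoc], b, a_mul_inl_mul_a,
      ← map_mul, ← map_pow]
    simp [sq, inl_mk_one_one]
  bc := by
    rw [show ((b : OddModel k) * c) ^ 4 = (b * (c * b * c)) ^ 2 by
      simp only [pow_succ, pow_zero, one_mul, mul_assoc], b, c_mul_inl_mul_c,
      ← map_mul, ← map_pow]
    simp [sq, exchange_sr_zero, inl_mk_one_one]
  ac := by
    rw [a, c, ← map_mul, ← map_pow, show ((Multiplicative.ofAdd 1, 1) *
      (1, Multiplicative.ofAdd 1) : Cyc 2 × Cyc 2) ^ 2 = 1 by decide, map_one]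

lemma aba_mul_cbc_pow : ((a : OddModel k) * b * a * (c * b * c)) ^ k = 1 := by
  rw [b, a_mul_inl_mul_a, c_mul_inl_mul_c, ← map_mul, ← map_pow]
  simp [exchange_sr_zero, inl_mk_one_one]

lemma eq_top_of_mem {S : Subgroup (OddModel k)} (ha : a ∈ S) (hb : b ∈ S) (hc : c ∈ S) :
    S = ⊤ := by
  have haba : inl (1, sr 0) ∈ S := by
    rw [← a_mul_inl_mul_a]
    exact mul_mem (mul_mem ha hb) ha
  have hcbc : inl (1, sr 1) ∈ S := by
    have := c_mul_inl_mul_c (k := k) (sr 0) 1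
    rw [exchange_sr_zero, map_one] at this
    rw [← this]
    exact mul_mem (mul_mem hc hb) hc
  have h1 : S.comap (inl.comp (MonoidHom.inl _ _)) = ⊤ := by
    refine DihedralGroup.eq_top_of_mem hb ?_
    have : inl (sr 1, 1) ∈ S := by
      rw [← a_mul_inl_mul_a]
      exact mul_mem (mul_mem ha hcbc) ha
    exact this
  have h2 : S.comap (inl.comp (MonoidHom.inr _ _)) = ⊤ :=
    DihedralGroup.eq_top_of_mem haba hcbc
  rw [eq_top_iff]
  rintro ⟨⟨u, v⟩, ⟨w, w'⟩⟩ -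
  have hu : inl (u, 1) ∈ S := (h1 ▸ Subgroup.mem_top u :)
  have hv : inl (1, v) ∈ S := (h2 ▸ Subgroup.mem_top v :)
  have hw : inr (w, 1) ∈ S := by
    rcases w.eq_one_or_eq with rfl | rfl
    · exact (map_one (inr : _ →* OddModel k)).symm ▸ one_mem S
    · exact ha
  have hw' : inr (1, w') ∈ S := by
    rcases w'.eq_one_or_eq with rfl | rfl
    · exact (map_one (inr : _ →* OddModel k)).symm ▸ one_mem S
    · exact hc
  rw [mk_eq_inl_mul_inr]
  refine mul_mem ?_ ?_
  · simpa [← map_mul] using mul_mem hu hv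
  · simpa [← map_mul] using mul_mem hw hw'

/-- The model has the presentation of the toroidal map of type `{4, 4}` with `2 * k ^ 2`
vertices. -/
lemma exists_hom {a' b' c' : H} (h : IsToroidal a' b' c')
    (hk : (a' * b' * a' * (c' * b' * c')) ^ k = 1) :
    ∃ g : OddModel k →* H, g a = a' ∧ g b = b' ∧ g c = c' := by
  have ha : a' ^ 2 = 1 := by rw [sq, h.sq_a]
  have hc : c' ^ 2 = 1 := by rw [sq, h.sq_c]
  have hia := inv_eq_self_of_mul_self h.sq_a
  have hic := inv_eq_self_of_mul_self h.sq_c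
  have haba := conj_mul_self h.sq_a h.sq_b
  have hcbc := conj_mul_self h.sq_c h.sq_b
  have haca := conj_mul_self h.sq_a hcbc
  have hconj {y : H} (hy : y * y = 1) (x : H) : y * (y * x * y) * y = x := by
    rw [show y * (y * x * y) * y = y * y * x * (y * y) by
      simp only [mul_assoc], hy, one_mul, mul_one]
  have hk' : (b' * (a' * (c' * b' * c') * a')) ^ k = 1 := by
    rw [show b' * (a' * (c' * b' * c') * a') = a' * (a' * b' * a' * (c' * b' * c')) * a' by
      rw [show a' * (a' * b' * a' * (c' * b' * c')) * a' =
        a' * a' * b' * (a' * (c' * b' * c') * a') by simp only [mul_assoc], h.sq_a, one_mul],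
      conj_pow_of_mul_self h.sq_a, hk, mul_one, h.sq_a]
  let f₁ := DihedralGroup.lift h.sq_b haca hk'
  let f₂ := DihedralGroup.lift haba hcbc hk
  have e10 : f₁ (sr 0) = b' := lift_sr_zero _ _ _
  have e11 : f₁ (sr 1) = a' * (c' * b' * c') * a' := lift_sr_one _ _ _
  have e20 : f₂ (sr 0) = a' * b' * a' := lift_sr_zero _ _ _
  have e21 : f₂ (sr 1) = c' * b' * c' := lift_sr_one _ _ _
  -- `a'` and `c'` commute, so they can be exchanged in the product of the four reflections
  have hac : a' * (c' * b' * c') * a' = c' * (a' * b' * a') * c' := by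
    rw [show a' * (c' * b' * c') * a' = a' * c' * b' * (c' * a') by simp only [mul_assoc],
      h.commute_ac.eq, ← h.commute_ac.eq]
    simp only [mul_assoc, h.commute_ac.eq]
  have hcomm (u v : DihedralGroup k) : Commute (f₁ u) (f₂ v) := by
    refine DihedralGroup.commute_of_commute ?_ ?_ ?_ ?_ u v
    · rw [e10, e20]
      exact h.commute_b_aba
    · rw [e10, e21]
      exact h.symm.commute_b_aba
    · rw [e11, e20]
      exact h.symm.commute_b_aba.symm.conj_of_mul_self h.sq_a
    · rw [e11, e21, hac]
      exact h.commute_b_aba.symm.conj_of_mul_self h.sq_c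
  let f := f₁.noncommCoprod f₂ hcomm
  -- conjugation by `a'` and `c'` on the two dihedral groups
  have h12 (u : DihedralGroup k) : a' * f₁ u * a'⁻¹ = f₂ u := by
    have : f₂ = ((MulAut.conj a').toMonoidHom).comp f₁ := DihedralGroup.hom_ext'
      (by simp [e20, e10, hia])
      (by simp [e21, e11, hia, hconj h.sq_a])
    rw [this]
    simp
  have h21 (u : DihedralGroup k) : a' * f₂ u * a'⁻¹ = f₁ u := by
    rw [← h12, hia, hconj h.sq_a]
  have h12' (u : DihedralGroup k) : c' * f₁ u * c'⁻¹ = f₂ (exchange u) := by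
    have : f₂.comp exchange.toMonoidHom = ((MulAut.conj c').toMonoidHom).comp f₁ :=
      DihedralGroup.hom_ext'
        (by simp [exchange_sr_zero, e21, e10, hic])
        (by simp [exchange_sr_one, e20, e11, hic, hac, hconj h.sq_c])
    exact (DFunLike.congr_fun this u).symm
  have h21' (u : DihedralGroup k) : c' * f₂ u * c'⁻¹ = f₁ (exchange u) := by
    have := h12' (exchange u)
    rw [exchange_exchange] at this
    rw [← this, hic, hconj h.sq_c]
  let fg := (cycLift ha).noncommCoprod (cycLift hc) (cycLift_commute ha hc h.commute_ac)
  have hf (u v) : f (u, v) = f₁ u * f₂ v := rfl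
  have hcompat_a : f.comp (swapExchangeAction k (Multiplicative.ofAdd 1, 1)).toMonoidHom =
      (MulAut.conj (fg (Multiplicative.ofAdd 1, 1))).toMonoidHom.comp f := by
    refine MonoidHom.ext fun ⟨u, v⟩ => ?_
    have : f (swapExchangeAction k (Multiplicative.ofAdd 1, 1) (u, v)) = a' * f (u, v) * a'⁻¹ := by
      rw [swapExchangeAction_one_left, Prod.swap_prod_mk, hf, hf, ← conj_mul, h12, h21,
        (hcomm v u).eq]
    simpa [fg, cycLift_one] using this
  have hcompat_c : f.comp (swapExchangeAction k (1, Multiplicative.ofAdd 1)).toMonoidHom =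
      (MulAut.conj (fg (1, Multiplicative.ofAdd 1))).toMonoidHom.comp f := by
    refine MonoidHom.ext fun ⟨u, v⟩ => ?_
    have : f (swapExchangeAction k (1, Multiplicative.ofAdd 1) (u, v)) = c' * f (u, v) * c'⁻¹ := by
      rw [swapExchangeAction_one_right, hf, hf, ← conj_mul, h12', h21', (hcomm _ _).eq]
    simpa [fg, cycLift_one] using this
  have hcompat_one : f.comp (swapExchangeAction k 1).toMonoidHom =
      (MulAut.conj (fg 1)).toMonoidHom.comp f := by
    refine MonoidHom.ext fun p => ?_
    simp
  have hcompat_mul (w w' : Cyc 2 × Cyc 2)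
      (hw : f.comp (swapExchangeAction k w).toMonoidHom = (MulAut.conj (fg w)).toMonoidHom.comp f)
      (hw' : f.comp (swapExchangeAction k w').toMonoidHom =
        (MulAut.conj (fg w')).toMonoidHom.comp f) :
      f.comp (swapExchangeAction k (w * w')).toMonoidHom =
        (MulAut.conj (fg (w * w'))).toMonoidHom.comp f := by
    refine MonoidHom.ext fun p => ?_
    have h1 : f (swapExchangeAction k w (swapExchangeAction k w' p)) =
      fg w * f (swapExchangeAction k w' p) * (fg w)⁻¹ := DFunLike.congr_fun hw _
    have h2 : f (swapExchangeAction k w' p) = fg w' * f p * (fg w')⁻¹ := DFunLike.congr_fun hw' p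
    have h3 : f (swapExchangeAction k (w * w') p) = fg (w * w') * f p * (fg (w * w'))⁻¹ := by
      rw [map_mul, MulAut.mul_apply, h1, h2, map_mul, mul_inv_rev]
      simp only [mul_assoc]
    exact h3
  have hcompat (w : Cyc 2 × Cyc 2) : f.comp (swapExchangeAction k w).toMonoidHom =
      (MulAut.conj (fg w)).toMonoidHom.comp f := by
    obtain ⟨w, w'⟩ := w
    rw [show ((w, w') : Cyc 2 × Cyc 2) = (w, 1) * (1, w') by simp]
    refine hcompat_mul _ _ ?_ ?_
    · rcases w.eq_one_or_eq with rfl | rfl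
      · exact hcompat_one
      · exact hcompat_a
    · rcases w'.eq_one_or_eq with rfl | rfl
      · exact hcompat_one
      · exact hcompat_c
  refine ⟨SemidirectProduct.lift f fg hcompat, ?_, ?_, ?_⟩
  · rw [a, lift_inr]
    simp [fg, cycLift_one]
  · rw [b, lift_inl]
    simp [f, e10]
  · rw [c, lift_inr]
    simp [fg, cycLift_one]

end OddModel

end OddModel

/-! ### Homomorphisms out of the presented groups -/

section Presentation

variable {H : Type*} [Group H]

lemma comm'_eq_one_iff {x y : H} : comm' x y = 1 ↔ Commute x y := by
  rw [comm', mul_assoc, ← mul_inv_rev, inv_mul_eq_one, eq_comm]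
  rfl

/-- The elements `a`, `b`, `c` satisfy the relations of the presented group. -/
def SatisfiesRelators (m s t l : ℕ) (a b c : H) : Prop :=
  (∀ r ∈ baseRelators s t l a b c, r = 1) ∧ lastRelator m a b c = 1

lemma satisfiesRelators_iff {m s t l : ℕ} {a b c : H} : SatisfiesRelators m s t l a b c ↔
    (a * a = 1 ∧ b * b = 1 ∧ c * c = 1 ∧
      (a * b) ^ 2 ^ s = 1 ∧ (b * c) ^ 2 ^ t = 1 ∧ (a * c) ^ 2 ^ l = 1 ∧
      Commute ((a * b) ^ 4) c ∧ Commute a ((b * c) ^ 4) ∧ Commute ((a * c) ^ 2) b) ∧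
      lastRelator m a b c = 1 := by
  simp only [SatisfiesRelators, baseRelators, Set.mem_insert_iff, Set.mem_singleton_iff,
    forall_eq_or_imp, forall_eq, ← comm'_eq_one_iff, sq]

lemma map_comm' {H' : Type*} [Group H'] (f : H →* H') (x y : H) :
    f (comm' x y) = comm' (f x) (f y) := by
  simp [comm']

lemma map_lastRelator {H' : Type*} [Group H'] (f : H →* H') (m : ℕ) (a b c : H) :
    f (lastRelator m a b c) = lastRelator m (f a) (f b) (f c) := by
  unfold lastRelator
  split_ifs <;> simp [map_comm']

lemma map_baseRelators {H' : Type*} [Group H'] (f : H →* H') (s t l : ℕ) (a b c : H) :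
    f '' baseRelators s t l a b c = baseRelators s t l (f a) (f b) (f c) := by
  simp [baseRelators, Set.image_insert_eq, map_comm']

lemma SatisfiesRelators.map {H' : Type*} [Group H'] (f : H →* H') {m s t l : ℕ} {a b c : H}
    (h : SatisfiesRelators m s t l a b c) : SatisfiesRelators m s t l (f a) (f b) (f c) := by
  refine ⟨?_, by rw [← map_lastRelator, h.2, map_one]⟩
  rw [← map_baseRelators]
  rintro _ ⟨r, hr, rfl⟩
  rw [h.1 r hr, map_one]

lemma pow_two_pow_eq_one {x : H} (hx : x * x = 1) {k : ℕ} (hk : 1 ≤ k) : x ^ 2 ^ k = 1 := by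
  obtain ⟨k, rfl⟩ := Nat.exists_eq_add_of_le' hk
  rw [pow_succ', pow_mul, sq, hx, one_pow]

lemma satisfiesRelators_one_left {m s t l : ℕ} (hs : 1 ≤ s) (hl : 1 ≤ l) {b c : H}
    (hb : b * b = 1) (hc : c * c = 1) (hbc : (b * c) ^ 2 ^ t = 1) :
    SatisfiesRelators m s t l 1 b c := by
  have h2 : b ^ 2 = 1 := by rw [sq, hb]
  have h4 : b ^ 4 = 1 := pow_two_pow_eq_one hb (k := 2) one_le_two
  rw [satisfiesRelators_iff]
  refine ⟨⟨one_mul 1, hb, hc, ?_, hbc, ?_, ?_, Commute.one_left _, ?_⟩, ?_⟩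
  · rw [one_mul, pow_two_pow_eq_one hb hs]
  · rw [one_mul, pow_two_pow_eq_one hc hl]
  · rw [one_mul, h4]
    exact Commute.one_left _
  · rw [one_mul, sq, hc]
    exact Commute.one_left _
  · unfold lastRelator
    rw [one_mul, h2, comm'_eq_one_iff.2 (Commute.one_left _),
      comm'_eq_one_iff.2 (Commute.one_left _), one_pow, one_pow, ite_self]

lemma satisfiesRelators_one_mid {m s t l : ℕ} (hs : 1 ≤ s) (ht : 1 ≤ t) {a c : H}
    (ha : a * a = 1) (hc : c * c = 1) (hac : (a * c) ^ 2 ^ l = 1) :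
    SatisfiesRelators m s t l a 1 c := by
  have h2 : a ^ 2 = 1 := by rw [sq, ha]
  have h4 : a ^ 4 = 1 := pow_two_pow_eq_one ha (k := 2) one_le_two
  have h4' : c ^ 4 = 1 := pow_two_pow_eq_one hc (k := 2) one_le_two
  rw [satisfiesRelators_iff]
  refine ⟨⟨ha, one_mul 1, hc, ?_, ?_, hac, ?_, ?_, Commute.one_right _⟩, ?_⟩
  · rw [mul_one, pow_two_pow_eq_one ha hs]
  · rw [one_mul, pow_two_pow_eq_one hc ht]
  · rw [mul_one, h4]
    exact Commute.one_left _
  · rw [one_mul, h4']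
    exact Commute.one_right _
  · unfold lastRelator
    rw [mul_one, h2, comm'_eq_one_iff.2 (Commute.one_left _),
      comm'_eq_one_iff.2 (Commute.one_left _), one_pow, one_pow, ite_self]

lemma satisfiesRelators_one_right {m s t l : ℕ} (ht : 1 ≤ t) (hl : 1 ≤ l) {a b : H}
    (ha : a * a = 1) (hb : b * b = 1) (hab : (a * b) ^ 2 ^ s = 1) :
    SatisfiesRelators m s t l a b 1 := by
  have h2 : b ^ 2 = 1 := by rw [sq, hb]
  have h4 : b ^ 4 = 1 := pow_two_pow_eq_one hb (k := 2) one_le_two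
  rw [satisfiesRelators_iff]
  refine ⟨⟨ha, hb, one_mul 1, hab, ?_, ?_, Commute.one_right _, ?_, ?_⟩, ?_⟩
  · rw [mul_one, pow_two_pow_eq_one hb ht]
  · rw [mul_one, pow_two_pow_eq_one ha hl]
  · rw [mul_one, h4]
    exact Commute.one_right _
  · rw [mul_one, sq, ha]
    exact Commute.one_left _
  · unfold lastRelator
    rw [mul_one, h2, comm'_eq_one_iff.2 (Commute.one_right _), one_pow, one_pow, ite_self]

variable {n s t l : ℕ}

/-- The universal property of the presented group. -/
lemma exists_hypertopeLift {x y z : H} (h : SatisfiesRelators (n - s - t - l) s t l x y z) :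
    ∃ f : HypertopeGroup n s t l →* H, f (hypertopeGen n s t l 0) = x ∧
      f (hypertopeGen n s t l 1) = y ∧ f (hypertopeGen n s t l 2) = z := by
  let F : FreeGroup (Fin 3) →* H := FreeGroup.lift ![x, y, z]
  have h0 : F (FreeGroup.of 0) = x := FreeGroup.lift_apply_of
  have h1 : F (FreeGroup.of 1) = y := FreeGroup.lift_apply_of
  have h2 : F (FreeGroup.of 2) = z := FreeGroup.lift_apply_of
  have hF : ∀ r ∈ hypertopeRelators n s t l, F r = 1 := by
    rintro r (hr | hr)
    · have := Set.mem_image_of_mem F hr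
      rw [map_baseRelators, h0, h1, h2] at this
      exact h.1 _ this
    · rw [Set.mem_singleton_iff.1 hr, map_lastRelator, h0, h1, h2]
      exact h.2
  exact ⟨PresentedGroup.toGroup hF, h0, h1, h2⟩

lemma satisfiesRelators_hypertopeGen (n s t l : ℕ) :
    SatisfiesRelators (n - s - t - l) s t l (hypertopeGen n s t l 0) (hypertopeGen n s t l 1)
      (hypertopeGen n s t l 2) := by
  refine ⟨?_, ?_⟩
  · change ∀ r ∈ baseRelators s t l (PresentedGroup.mk _ (FreeGroup.of 0))
      (PresentedGroup.mk _ (FreeGroup.of 1)) (PresentedGroup.mk _ (FreeGroup.of 2)), r = 1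
    rw [← map_baseRelators]
    rintro _ ⟨r, hr, rfl⟩
    exact PresentedGroup.one_of_mem (Or.inl hr)
  · refine (map_lastRelator (PresentedGroup.mk _) _ (FreeGroup.of 0) (FreeGroup.of 1)
      (FreeGroup.of 2)).symm.trans ?_
    exact PresentedGroup.one_of_mem (Or.inr rfl)

lemma hypertopeGen_mul_self (i : Fin 3) :
    hypertopeGen n s t l i * hypertopeGen n s t l i = 1 := by
  have h := (satisfiesRelators_iff.1 (satisfiesRelators_hypertopeGen n s t l)).1
  fin_cases i
  · exact h.1
  · exact h.2.1
  · exact h.2.2.1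

lemma parabolic_hypertopeGen_univ : parabolic (hypertopeGen n s t l) Set.univ = ⊤ := by
  rw [parabolic, Set.image_univ]
  exact PresentedGroup.closure_range_of _

/-- The relations remain valid when one of the generators is replaced by `1`. -/
lemma hasRetractions_hypertopeGen (hs : 1 ≤ s) (ht : 1 ≤ t) (hl : 1 ≤ l) :
    HasRetractions (hypertopeGen n s t l) := by
  classical
  intro J
  let x : Fin 3 → HypertopeGroup n s t l := fun i => if i ∈ J then hypertopeGen n s t l i else 1
  have hx (i : Fin 3) : x i * x i = 1 := by
    by_cases hi : i ∈ J
    · simp [x, hi, hypertopeGen_mul_self]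
    · simp [x, hi]
  have hxy {i j : Fin 3} {k : ℕ} (hk : 1 ≤ k)
      (h : (hypertopeGen n s t l i * hypertopeGen n s t l j) ^ 2 ^ k = 1) :
      (x i * x j) ^ 2 ^ k = 1 := by
    by_cases hi : i ∈ J
    · by_cases hj : j ∈ J
      · simpa [x, hi, hj] using h
      · rw [show x j = 1 by simp [x, hj], mul_one, pow_two_pow_eq_one (hx i) hk]
    · rw [show x i = 1 by simp [x, hi], one_mul, pow_two_pow_eq_one (hx j) hk]
  obtain ⟨⟨-, -, -, hab, hbc, hac, -⟩, -⟩ :=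
    satisfiesRelators_iff.1 (satisfiesRelators_hypertopeGen n s t l)
  have hrel : SatisfiesRelators (n - s - t - l) s t l (x 0) (x 1) (x 2) := by
    by_cases h0 : 0 ∈ J
    · by_cases h1 : 1 ∈ J
      · by_cases h2 : 2 ∈ J
        · simpa [x, h0, h1, h2] using satisfiesRelators_hypertopeGen n s t l
        · rw [show x 2 = 1 by simp [x, h2]]
          exact satisfiesRelators_one_right ht hl (hx 0) (hx 1) (hxy hs hab)
      · rw [show x 1 = 1 by simp [x, h1]]
        exact satisfiesRelators_one_mid hs ht (hx 0) (hx 2) (hxy hl hac)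
    · rw [show x 0 = 1 by simp [x, h0]]
      exact satisfiesRelators_one_left hs hl (hx 1) (hx 2) (hxy ht hbc)
  obtain ⟨f, hf0, hf1, hf2⟩ := exists_hypertopeLift hrel
  have hf (i : Fin 3) : f (hypertopeGen n s t l i) = x i := by
    fin_cases i
    · exact hf0
    · exact hf1
    · exact hf2
  exact ⟨f, fun j hj => by simp [hf, x, hj], fun j hj => by simp [hf, x, hj]⟩

/-! ### The dihedral quotients -/

open DihedralGroup (sr r)

lemma sr_zero_mul_sr_one_pow (k : ℕ) : (sr 0 * sr 1 : DihedralGroup k) ^ k = 1 := by simp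

lemma exists_hom_dihedral_zero_one (n s : ℕ) (ht : 1 ≤ t) (hl : 1 ≤ l) :
    ∃ f : HypertopeGroup n s t l →* DihedralGroup (2 ^ s), f (hypertopeGen n s t l 0) = sr 0 ∧
      f (hypertopeGen n s t l 1) = sr 1 ∧ f (hypertopeGen n s t l 2) = 1 :=
  exists_hypertopeLift
    (satisfiesRelators_one_right ht hl (DihedralGroup.sr_mul_self 0) (DihedralGroup.sr_mul_self 1)
      (sr_zero_mul_sr_one_pow (2 ^ s)))

lemma exists_hom_dihedral_one_two (n t : ℕ) (hs : 1 ≤ s) (hl : 1 ≤ l) :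
    ∃ f : HypertopeGroup n s t l →* DihedralGroup (2 ^ t), f (hypertopeGen n s t l 0) = 1 ∧
      f (hypertopeGen n s t l 1) = sr 0 ∧ f (hypertopeGen n s t l 2) = sr 1 :=
  exists_hypertopeLift
    (satisfiesRelators_one_left hs hl (DihedralGroup.sr_mul_self 0) (DihedralGroup.sr_mul_self 1)
      (sr_zero_mul_sr_one_pow (2 ^ t)))

lemma exists_hom_dihedral_zero_two (n l : ℕ) (hs : 1 ≤ s) (ht : 1 ≤ t) :
    ∃ f : HypertopeGroup n s t l →* DihedralGroup (2 ^ l), f (hypertopeGen n s t l 0) = sr 0 ∧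
      f (hypertopeGen n s t l 1) = 1 ∧ f (hypertopeGen n s t l 2) = sr 1 :=
  exists_hypertopeLift
    (satisfiesRelators_one_mid hs ht (DihedralGroup.sr_mul_self 0) (DihedralGroup.sr_mul_self 1)
      (sr_zero_mul_sr_one_pow (2 ^ l)))

/-- Two involutions with `(ρ i * ρ j) ^ k = 1` generate a quotient of the dihedral group of order
`2 * k`; a homomorphism that maps them to the two generating reflections shows that the quotient
is not proper. -/
lemma card_parabolic_pair {ι : Type*} {ρ : ι → H} {i j : ι} {k : ℕ} (hi : ρ i * ρ i = 1)
    (hj : ρ j * ρ j = 1) (hij : (ρ i * ρ j) ^ k = 1) (f : H →* DihedralGroup k)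
    (hfi : f (ρ i) = sr 0) (hfj : f (ρ j) = sr 1) :
    Nat.card (parabolic ρ {i, j}) = 2 * k := by
  let g := DihedralGroup.lift hi hj hij
  have hg0 : g (sr 0) = ρ i := DihedralGroup.lift_sr_zero _ _ _
  have hg1 : g (sr 1) = ρ j := DihedralGroup.lift_sr_one _ _ _
  have hfg : f.comp g = MonoidHom.id _ := DihedralGroup.hom_ext'
    (by simp [hg0, hfi]) (by simp [hg1, hfj])
  have hinj : Function.Injective g :=
    Function.LeftInverse.injective fun x => DFunLike.congr_fun hfg x
  have hrange : g.range = parabolic ρ {i, j} := by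
    refine le_antisymm ?_ ((Subgroup.closure_le _).2 ?_)
    · rw [MonoidHom.range_eq_map, Subgroup.map_le_iff_le_comap, top_le_iff]
      exact DihedralGroup.eq_top_of_mem (by simp [hg0, mem_parabolic])
        (by simp [hg1, mem_parabolic])
    · rintro _ ⟨o, rfl | rfl, rfl⟩
      · exact ⟨sr 0, hg0⟩
      · exact ⟨sr 1, hg1⟩
  rw [← hrange, ← Nat.card_congr (MonoidHom.ofInjective hinj).toEquiv, DihedralGroup.nat_card]

lemma orderOf_eq_of_map_eq_r_one {k : ℕ} {x : H} (hx : x ^ k = 1) (f : H →* DihedralGroup k)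
    (hf : f x = r 1) : orderOf x = k :=
  Nat.dvd_antisymm (orderOf_dvd_of_pow_eq_one hx)
    (by simpa [hf] using orderOf_map_dvd f x)

lemma isCGroup_hypertopeGen (hs : 1 ≤ s) (ht : 1 ≤ t) (hl : 1 ≤ l) :
    IsCGroup (hypertopeGen n s t l) := by
  refine ⟨parabolic_hypertopeGen_univ, fun i => ?_,
    (hasRetractions_hypertopeGen hs ht hl).parabolic_inf⟩
  have h2 : hypertopeGen n s t l i ^ 2 = 1 := by rw [sq, hypertopeGen_mul_self]
  refine orderOf_eq_prime h2 fun h1 => ?_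
  obtain ⟨f, hf0, hf1, -⟩ := exists_hom_dihedral_zero_one n s ht hl
  obtain ⟨g, -, -, hg2⟩ := exists_hom_dihedral_one_two n t hs hl
  have h (k : ℕ) (u : ZMod k) (e : (1 : DihedralGroup k) = sr u) : False := by
    rw [DihedralGroup.one_def] at e
    cases e
  fin_cases i
  · exact h _ 0 (by rw [← hf0, show hypertopeGen n s t l 0 = 1 from h1, map_one])
  · exact h _ 1 (by rw [← hf1, show hypertopeGen n s t l 1 = 1 from h1, map_one])
  · exact h _ 1 (by rw [← hg2, show hypertopeGen n s t l 2 = 1 from h1, map_one])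

end Presentation

/-! ### The abelian normal subgroup and the order of the group -/

section Structure

variable {H : Type*} [Group H] {m s t l : ℕ} {a b c : H}

lemma IsExtensionOf.card {G K Q : Type*} [Group G] [Group K] [Group Q] (h : IsExtensionOf G K Q) :
    Nat.card G = Nat.card K * Nat.card Q := by
  obtain ⟨N, _, ⟨e⟩, ⟨e'⟩⟩ := h
  rw [Subgroup.card_eq_card_quotient_mul_card_subgroup N, Nat.card_congr e.toEquiv,
    Nat.card_congr e'.toEquiv, mul_comm]

lemma pow_pow_two_pow_sub {x : H} {k d : ℕ} (hd : d ≤ k) (hx : x ^ 2 ^ k = 1) :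
    (x ^ 2 ^ d) ^ 2 ^ (k - d) = 1 := by
  rw [← pow_mul, ← pow_add, Nat.add_sub_cancel' hd, hx]

lemma orderOf_pow_two_pow {x : H} {k d : ℕ} (hd : d ≤ k) (hx : orderOf x = 2 ^ k) :
    orderOf (x ^ 2 ^ d) = 2 ^ (k - d) := by
  rw [orderOf_pow_of_dvd (by positivity) (hx ▸ pow_dvd_pow 2 hd), hx, Nat.pow_div hd two_pos]

lemma SemiconjBy.pow_inv_right {g x : H} (h : SemiconjBy g x x⁻¹) (k : ℕ) :
    SemiconjBy g (x ^ k) (x ^ k)⁻¹ := by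
  rw [← inv_pow]
  exact h.pow_right k

/-- An even power of a product of two elements that invert or centralize `x` commutes with `x`. -/
lemma commute_mul_pow {g h x : H} (hg : SemiconjBy g x x⁻¹ ∨ Commute g x)
    (hh : SemiconjBy h x x⁻¹ ∨ Commute h x) {k : ℕ} (hk : Even k) : Commute ((g * h) ^ k) x := by
  have hinv {u : H} (hu : SemiconjBy u x x⁻¹) : SemiconjBy u x⁻¹ x := by simpa using hu.inv_right
  have h1 : SemiconjBy (g * h) x x⁻¹ ∨ Commute (g * h) x := by
    rcases hg with hg | hg <;> rcases hh with hh | hh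
    · exact Or.inr ((hinv hg).mul_left hh)
    · exact Or.inl (SemiconjBy.mul_left hg hh)
    · exact Or.inl (SemiconjBy.mul_left hg.inv_right hh)
    · exact Or.inr (Commute.mul_left hg hh)
  obtain ⟨d, rfl⟩ := hk
  rw [← two_mul, pow_mul]
  rcases h1 with h1 | h1
  · rw [sq]
    exact Commute.pow_left ((hinv h1).mul_left h1) d
  · exact (h1.pow_left 2).pow_left d

namespace SatisfiesRelators

/-- The powers `(a b) ^ 4`, `(b c) ^ 4`, `(a c) ^ 2` commute with each other: each of them is
centralized or inverted by `a`, `b` and `c`. -/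
lemma commute_pow (h : SatisfiesRelators m s t l a b c) :
    Commute ((a * b) ^ 4) ((b * c) ^ 4) ∧ Commute ((a * b) ^ 4) ((a * c) ^ 2) ∧
      Commute ((b * c) ^ 4) ((a * c) ^ 2) := by
  obtain ⟨⟨ha, hb, hc, -, -, -, hab, hbc, hac⟩, -⟩ := satisfiesRelators_iff.1 h
  refine ⟨?_, ?_, ?_⟩
  · exact commute_mul_pow (Or.inr hbc) (Or.inl ((semiconjBy_mul_inv hb hc).pow_inv_right 4))
      (by decide)
  · exact (commute_mul_pow (Or.inl ((semiconjBy_mul_inv ha hb).pow_inv_right 4))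
      (Or.inr hab.symm) (by decide)).symm
  · exact commute_mul_pow (Or.inr hac.symm)
      (Or.inl ((semiconjBy_mul_inv' ha hc).pow_inv_right 2)) (by decide)

/-- The homomorphism from the product of three cyclic groups given by the powers of `(a b) ^ 4`,
`(b c) ^ 4` and `(a c) ^ 2`. -/
def kernelHom (h : SatisfiesRelators m s t l a b c) (hs : 2 ≤ s) (ht : 2 ≤ t) (hl : 1 ≤ l) :
    Cyc (2 ^ (s - 2)) × Cyc (2 ^ (t - 2)) × Cyc (2 ^ (l - 1)) →* H :=
  have hr := (satisfiesRelators_iff.1 h).1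
  have hA : ((a * b) ^ 4) ^ 2 ^ (s - 2) = 1 := pow_pow_two_pow_sub hs hr.2.2.2.1
  have hB : ((b * c) ^ 4) ^ 2 ^ (t - 2) = 1 := pow_pow_two_pow_sub ht hr.2.2.2.2.1
  have hC : ((a * c) ^ 2) ^ 2 ^ (l - 1) = 1 := pow_pow_two_pow_sub hl hr.2.2.2.2.2.1
  (cycLift hA).noncommCoprod
    ((cycLift hB).noncommCoprod (cycLift hC) (cycLift_commute hB hC h.commute_pow.2.2))
    fun u v => (cycLift_commute hA hB h.commute_pow.1 u v.1).mul_right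
      (cycLift_commute hA hC h.commute_pow.2.1 u v.2)

variable (h : SatisfiesRelators m s t l a b c) (hs : 2 ≤ s) (ht : 2 ≤ t) (hl : 1 ≤ l)

lemma kernelHom_apply (i j k : ℤ) :
    h.kernelHom hs ht hl (Multiplicative.ofAdd (i : ZMod (2 ^ (s - 2))),
      Multiplicative.ofAdd (j : ZMod (2 ^ (t - 2))),
      Multiplicative.ofAdd (k : ZMod (2 ^ (l - 1)))) =
      ((a * b) ^ 4) ^ i * (((b * c) ^ 4) ^ j * ((a * c) ^ 2) ^ k) := by
  have hr := (satisfiesRelators_iff.1 h).1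
  have hA : ((a * b) ^ 4) ^ 2 ^ (s - 2) = 1 := pow_pow_two_pow_sub hs hr.2.2.2.1
  have hB : ((b * c) ^ 4) ^ 2 ^ (t - 2) = 1 := pow_pow_two_pow_sub ht hr.2.2.2.2.1
  have hC : ((a * c) ^ 2) ^ 2 ^ (l - 1) = 1 := pow_pow_two_pow_sub hl hr.2.2.2.2.2.1
  rw [← cycLift_intCast hA, ← cycLift_intCast hB, ← cycLift_intCast hC]
  rfl

lemma mem_range_kernelHom {x : H} : x ∈ (h.kernelHom hs ht hl).range ↔
    ∃ i j k : ℤ, x = ((a * b) ^ 4) ^ i * (((b * c) ^ 4) ^ j * ((a * c) ^ 2) ^ k) := by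
  constructor
  · rintro ⟨⟨u, v, w⟩, rfl⟩
    obtain ⟨i, rfl⟩ := u.exists_eq
    obtain ⟨j, rfl⟩ := v.exists_eq
    obtain ⟨k, rfl⟩ := w.exists_eq
    exact ⟨i, j, k, kernelHom_apply h hs ht hl i j k⟩
  · rintro ⟨i, j, k, rfl⟩
    exact ⟨_, kernelHom_apply h hs ht hl i j k⟩

/-- The subgroup generated by `(a b) ^ 4`, `(b c) ^ 4` and `(a c) ^ 2` is normal. -/
lemma normal_range_kernelHom (hgen : Subgroup.closure {a, b, c} = ⊤) :
    (h.kernelHom hs ht hl).range.Normal := by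
  obtain ⟨⟨ha, hb, hc, -, -, -, hab, hbc, hac⟩, -⟩ := satisfiesRelators_iff.1 h
  have hconj {g y z : H} (e : SemiconjBy g y z) (hg : g * g = 1)
      (hz : z ∈ (h.kernelHom hs ht hl).range) : g * y * g⁻¹ ∈ (h.kernelHom hs ht hl).range := by
    rwa [e.eq, mul_inv_cancel_right]
  -- each generator inverts two of the three powers and commutes with the third one
  have key (g : H) (hg : g ∈ ({a, b, c} : Set H)) (x : H)
      (hx : x ∈ (h.kernelHom hs ht hl).range) : g * x * g⁻¹ ∈ (h.kernelHom hs ht hl).range := by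
    obtain ⟨i, j, k, rfl⟩ := (mem_range_kernelHom h hs ht hl).1 hx
    rcases hg with rfl | rfl | rfl
    · refine hconj ((((semiconjBy_mul_inv ha hb).pow_inv_right 4).zpow_right i).mul_right
        (SemiconjBy.mul_right (hbc.zpow_right j)
          (((semiconjBy_mul_inv ha hc).pow_inv_right 2).zpow_right k))) ha ?_
      exact (mem_range_kernelHom h hs ht hl).2 ⟨-i, j, -k, by simp only [inv_zpow']⟩
    · refine hconj ((((semiconjBy_mul_inv' ha hb).pow_inv_right 4).zpow_right i).mul_right
        (SemiconjBy.mul_right (((semiconjBy_mul_inv hb hc).pow_inv_right 4).zpow_right j)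
          (hac.symm.zpow_right k))) hb ?_
      exact (mem_range_kernelHom h hs ht hl).2 ⟨-i, -j, k, by simp only [inv_zpow']⟩
    · refine hconj (SemiconjBy.mul_right (hab.symm.zpow_right i)
        (SemiconjBy.mul_right (((semiconjBy_mul_inv' hb hc).pow_inv_right 4).zpow_right j)
          (((semiconjBy_mul_inv' ha hc).pow_inv_right 2).zpow_right k))) hc ?_
      exact (mem_range_kernelHom h hs ht hl).2 ⟨i, -j, -k, by simp only [inv_zpow']⟩
  have hinv (g : H) (hg : g ∈ ({a, b, c} : Set H)) : g⁻¹ = g := by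
    rcases hg with rfl | rfl | rfl
    · exact inv_eq_self_of_mul_self ha
    · exact inv_eq_self_of_mul_self hb
    · exact inv_eq_self_of_mul_self hc
  refine ⟨fun x hx g => ?_⟩
  have hg : g ∈ Subgroup.closure {a, b, c} := hgen ▸ Subgroup.mem_top g
  induction hg using Subgroup.closure_induction_left with
  | one => simpa using hx
  | mul_left g hg p hp ih =>
    have := key g hg _ ih
    rwa [show g * p * x * (g * p)⁻¹ = g * (p * x * p⁻¹) * g⁻¹ by
      simp only [mul_inv_rev, mul_assoc]]
  | inv_mul_cancel g hg p hp ih =>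
    have := key g hg _ ih
    rwa [hinv g hg, show g * p * x * (g * p)⁻¹ = g * (p * x * p⁻¹) * g⁻¹ by
      simp only [mul_inv_rev, mul_assoc]]

/-- When the three powers are separated by dihedral quotients, they are independent. -/
lemma kernelHom_injective
    (f : H →* DihedralGroup (2 ^ s)) (hf : f a = .sr 0 ∧ f b = .sr 1 ∧ f c = 1)
    (f' : H →* DihedralGroup (2 ^ t)) (hf' : f' a = 1 ∧ f' b = .sr 0 ∧ f' c = .sr 1)
    (f'' : H →* DihedralGroup (2 ^ l)) (hf'' : f'' a = .sr 0 ∧ f'' b = 1 ∧ f'' c = .sr 1) :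
    Function.Injective (h.kernelHom hs ht hl) := by
  rw [injective_iff_map_eq_one]
  rintro ⟨u, v, w⟩ huvw
  obtain ⟨i, rfl⟩ := u.exists_eq
  obtain ⟨j, rfl⟩ := v.exists_eq
  obtain ⟨k, rfl⟩ := w.exists_eq
  rw [kernelHom_apply] at huvw
  have hr {e d : ℕ} (hd : d ≤ e) {i : ℤ}
      {q : ℕ} (hq : q = 2 ^ d) (hi : ((DihedralGroup.r 1 : DihedralGroup (2 ^ e)) ^ q) ^ i = 1) :
      Multiplicative.ofAdd (i : ZMod (2 ^ (e - d))) = 1 := by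
    rw [hq, ← orderOf_dvd_iff_zpow_eq_one, orderOf_pow_two_pow hd DihedralGroup.orderOf_r_one] at hi
    rw [(ZMod.intCast_zmod_eq_zero_iff_dvd i _).2 hi]
    rfl
  have h2 {d : ℕ} (x : ZMod d) : (DihedralGroup.sr x) ^ 2 = 1 := by
    rw [sq, DihedralGroup.sr_mul_self]
  have h4 {d : ℕ} (x : ZMod d) : (DihedralGroup.sr x) ^ 4 = 1 :=
    pow_two_pow_eq_one (k := 2) (DihedralGroup.sr_mul_self x) one_le_two
  refine Prod.ext (hr hs (q := 4) rfl ?_)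
    (Prod.ext (hr ht (q := 4) rfl ?_) (hr hl (q := 2) rfl ?_))
  · simpa only [map_mul, map_zpow, map_pow, hf, map_one, mul_one, one_mul, h2, h4, one_zpow,
      DihedralGroup.sr_mul_sr, sub_zero] using congrArg f huvw
  · simpa only [map_mul, map_zpow, map_pow, hf', map_one, mul_one, one_mul, h2, h4, one_zpow,
      DihedralGroup.sr_mul_sr, sub_zero] using congrArg f' huvw
  · simpa only [map_mul, map_zpow, map_pow, hf'', map_one, mul_one, one_mul, h2, h4, one_zpow,
      DihedralGroup.sr_mul_sr, sub_zero] using congrArg f'' huvw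

end SatisfiesRelators

/-- Elements that satisfy the relations of the Coxeter group of type `{4, 4}` and the last relation
satisfy all relations. -/
lemma IsToroidal.satisfiesRelators (h : IsToroidal a b c) (hs : 2 ≤ s) (ht : 2 ≤ t) (hl : 1 ≤ l)
    (hm : lastRelator m a b c = 1) : SatisfiesRelators m s t l a b c := by
  have hpow {x : H} {k d : ℕ} (hd : d ≤ k) (hx : x ^ 2 ^ d = 1) : x ^ 2 ^ k = 1 := by
    rw [← Nat.add_sub_cancel' hd, pow_add, pow_mul, hx, one_pow]
  refine satisfiesRelators_iff.2 ⟨⟨h.sq_a, h.sq_b, h.sq_c, hpow hs h.ab, hpow ht h.bc,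
    hpow hl (by simpa using h.ac), ?_, ?_, ?_⟩, hm⟩
  · rw [h.ab]
    exact Commute.one_left _
  · rw [h.bc]
    exact Commute.one_right _
  · rw [h.ac]
    exact Commute.one_left _

lemma IsToroidal.lastRelator_of_even (h : IsToroidal a b c) (hm : Even m) :
    lastRelator m a b c = (b * a * b * c) ^ 2 ^ ((m + 2) / 2) := by
  rw [lastRelator, if_pos hm, h.comm'_sq_c, ← pow_mul, ← pow_succ',
    show m / 2 + 1 = (m + 2) / 2 by omega]

lemma IsToroidal.lastRelator_of_odd (h : IsToroidal a b c) (hm : Odd m) :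
    lastRelator m a b c = (a * b * a * (c * b * c)) ^ 2 ^ ((m + 1) / 2) := by
  obtain ⟨d, rfl⟩ := hm
  rw [lastRelator, if_neg (by simp), h.comm'_sq_sq, ← pow_mul, ← pow_succ',
    show (2 * d + 1 - 1) / 2 + 1 = (2 * d + 1 + 1) / 2 by omega]

variable {n : ℕ}

lemma closure_hypertopeGen : Subgroup.closure {hypertopeGen n s t l 0, hypertopeGen n s t l 1,
    hypertopeGen n s t l 2} = ⊤ := by
  rw [← parabolic_hypertopeGen_univ, parabolic]
  congr 1
  ext x
  simp [Fin.exists_fin_succ, eq_comm]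

/-- If the group `Q`, generated by `x`, `y`, `z`, is presented by the relations of the Coxeter group
of type `{4, 4}` and the last relation, then the presented group is an extension by `Q` of
the abelian normal subgroup. -/
lemma isExtensionOf_hypertopeGroup {Q : Type} [Group Q] (hs : 2 ≤ s) (ht : 2 ≤ t) (hl : 1 ≤ l)
    {x y z : Q} (hQ : IsToroidal x y z) (hlast : lastRelator (n - s - t - l) x y z = 1)
    (hgen : ∀ S : Subgroup Q, x ∈ S → y ∈ S → z ∈ S → S = ⊤)
    (huniv : ∀ (H : Type) [Group H] (a b c : H), IsToroidal a b c →
      lastRelator (n - s - t - l) a b c = 1 → ∃ g : Q →* H, g x = a ∧ g y = b ∧ g z = c) :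
    IsExtensionOf (HypertopeGroup n s t l)
      (Cyc (2 ^ (s - 2)) × Cyc (2 ^ (t - 2)) × Cyc (2 ^ (l - 1))) Q := by
  have hs' : 1 ≤ s := one_le_two.trans hs
  have ht' : 1 ≤ t := one_le_two.trans ht
  have h := satisfiesRelators_hypertopeGen n s t l
  obtain ⟨f, hfx, hfy, hfz⟩ := exists_hypertopeLift (hQ.satisfiesRelators hs ht hl hlast)
  have hsurj : Function.Surjective f := MonoidHom.range_eq_top.1
    (hgen _ ⟨_, hfx⟩ ⟨_, hfy⟩ ⟨_, hfz⟩)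
  have hnormal := h.normal_range_kernelHom hs ht hl closure_hypertopeGen
  have hmem (i j k : ℤ) := (h.mem_range_kernelHom hs ht hl).2 ⟨i, j, k, rfl⟩
  set N := (h.kernelHom hs ht hl).range
  have hker : f.ker = N := by
    refine le_antisymm ?_ ?_
    · let π := QuotientGroup.mk' N
      have hπ := h.map π
      obtain ⟨⟨ha, hb, hc, -⟩, hlast'⟩ := satisfiesRelators_iff.1 hπ
      obtain ⟨g, hgx, hgy, hgz⟩ := huniv _ _ _ _ (IsToroidal.mk ha hb hc
        (by
          rw [← map_mul, ← map_pow]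
          exact (QuotientGroup.eq_one_iff _).2 (by simpa using hmem 1 0 0))
        (by
          rw [← map_mul, ← map_pow]
          exact (QuotientGroup.eq_one_iff _).2 (by simpa using hmem 0 1 0))
        (by
          rw [← map_mul, ← map_pow]
          exact (QuotientGroup.eq_one_iff _).2 (by simpa using hmem 0 0 1))) hlast'
      have hgf : g.comp f = π := PresentedGroup.ext fun i => by
        change g (f (hypertopeGen n s t l i)) = π (hypertopeGen n s t l i)
        fin_cases i
        · exact (congrArg g hfx).trans hgx
        · exact (congrArg g hfy).trans hgy
        · exact (congrArg g hfz).trans hgz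
      intro u hu
      refine (QuotientGroup.eq_one_iff u).1 ?_
      have := DFunLike.congr_fun hgf u
      rw [MonoidHom.comp_apply, MonoidHom.mem_ker.1 hu, map_one] at this
      exact this.symm
    · intro u hu
      obtain ⟨i, j, k, rfl⟩ := (h.mem_range_kernelHom hs ht hl).1 hu
      simp only [MonoidHom.mem_ker, map_mul, map_zpow, map_pow, hfx, hfy, hfz, hQ.ab, hQ.bc,
        hQ.ac, one_zpow, one_mul]
  obtain ⟨f₁, hf₁⟩ := exists_hom_dihedral_zero_one n s ht' hl
  obtain ⟨f₂, hf₂⟩ := exists_hom_dihedral_one_two n t hs' hl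
  obtain ⟨f₃, hf₃⟩ := exists_hom_dihedral_zero_two n l hs' ht'
  refine ⟨N, hnormal, ⟨(MonoidHom.ofInjective
    (h.kernelHom_injective hs ht hl f₁ hf₁ f₂ hf₂ f₃ hf₃)).symm⟩, ⟨?_⟩⟩
  exact (QuotientGroup.quotientMulEquivOfEq hker.symm).trans
    (QuotientGroup.quotientKerEquivOfSurjective f hsurj)

lemma isExtensionOf_evenModel (hs : 2 ≤ s) (ht : 2 ≤ t) (hl : 1 ≤ l)
    (hm : Even (n - s - t - l)) : IsExtensionOf (HypertopeGroup n s t l)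
      (Cyc (2 ^ (s - 2)) × Cyc (2 ^ (t - 2)) × Cyc (2 ^ (l - 1)))
      (EvenModel (2 ^ ((n - s - t - l + 2) / 2))) := by
  refine isExtensionOf_hypertopeGroup hs ht hl EvenModel.isToroidal ?_
    (fun S => EvenModel.eq_top_of_mem) fun H _ a b c h hlast => EvenModel.exists_hom h ?_
  · rw [EvenModel.isToroidal.lastRelator_of_even hm, EvenModel.bab_mul_c_pow]
  · rw [← h.lastRelator_of_even hm, hlast]

lemma isExtensionOf_oddModel (hs : 2 ≤ s) (ht : 2 ≤ t) (hl : 1 ≤ l)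
    (hm : Odd (n - s - t - l)) : IsExtensionOf (HypertopeGroup n s t l)
      (Cyc (2 ^ (s - 2)) × Cyc (2 ^ (t - 2)) × Cyc (2 ^ (l - 1)))
      (OddModel (2 ^ ((n - s - t - l + 1) / 2))) := by
  refine isExtensionOf_hypertopeGroup hs ht hl OddModel.isToroidal ?_
    (fun S => OddModel.eq_top_of_mem) fun H _ a b c h hlast => OddModel.exists_hom h ?_
  · rw [OddModel.isToroidal.lastRelator_of_odd hm, OddModel.aba_mul_cbc_pow]
  · rw [← h.lastRelator_of_odd hm, hlast]

lemma card_cyc (k : ℕ) : Nat.card (Cyc k) = k := Nat.card_zmod k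

lemma card_hypertopeGroup (hs : 2 ≤ s) (ht : 2 ≤ t) (hl : 1 ≤ l) (hn : s + t + l ≤ n) :
    Nat.card (HypertopeGroup n s t l) = 2 ^ n := by
  have hprod (x y z k e : ℕ) : 2 ^ x * (2 ^ y * 2 ^ z) * (2 * 2 ^ k * (2 * 2 ^ k) * 2 ^ e) =
      2 ^ (x + y + z + 2 * k + 2 + e) := by ring
  rcases Nat.even_or_odd (n - s - t - l) with hm | hm
  · rw [(isExtensionOf_evenModel hs ht hl hm).card]
    have h := hprod (s - 2) (t - 2) (l - 1) ((n - s - t - l + 2) / 2) 1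
    simp only [Nat.card_prod, SemidirectProduct.card, card_cyc, DihedralGroup.nat_card]
    rw [pow_one] at h
    rw [h]
    congr 1
    obtain ⟨d, hd⟩ := hm
    omega
  · rw [(isExtensionOf_oddModel hs ht hl hm).card]
    have h := hprod (s - 2) (t - 2) (l - 1) ((n - s - t - l + 1) / 2) 2
    simp only [Nat.card_prod, SemidirectProduct.card, card_cyc, DihedralGroup.nat_card]
    rw [sq] at h
    rw [h]
    congr 1
    obtain ⟨d, hd⟩ := hm
    omega

end Structure

/-! ### The hypertope of the presented group -/

theorem theorem3p2 (n s t l : ℕ) (hn : 10 ≤ n) (hs : 2 ≤ s) (ht : 2 ≤ t) (hl : 1 ≤ l)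
    (hstl : s + t + l ≤ n) :
    -- the order of the group, and the C-group property
    Nat.card (HypertopeGroup n s t l) = 2 ^ n ∧
    IsCGroup (hypertopeGen n s t l) ∧
    -- the coset geometry is a flag-transitive regular hypertope
    (hypertopeGeometry n s t l).IsHypertope ∧
    (hypertopeGeometry n s t l).IsFlagTransitive ∧
    (hypertopeGeometry n s t l).IsRegular ∧
    -- its type, through its rank two residues and through the orders of the products
    (hypertopeGeometry n s t l).HasType (2 ^ s) (2 ^ t) (2 ^ l) ∧
    orderOf (hypertopeGen n s t l 0 * hypertopeGen n s t l 1) = 2 ^ s ∧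
    orderOf (hypertopeGen n s t l 1 * hypertopeGen n s t l 2) = 2 ^ t ∧
    orderOf (hypertopeGen n s t l 0 * hypertopeGen n s t l 2) = 2 ^ l ∧
    -- its automorphism group is the presented group, acting by right multiplication
    (∃ φ : HypertopeGroup n s t l ≃* (hypertopeGeometry n s t l).autI,
      ∀ (g x : HypertopeGroup n s t l) (i : Fin 3),
        (φ g : Equiv.Perm (CosetElement (maximalParabolic (hypertopeGen n s t l))))
          (CosetElement.mk _ i x) = CosetElement.mk _ i (x * g⁻¹)) ∧
    -- the structure of the group; `DihedralGroup k` has order `2 * k`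
    (Even (n - s - t - l) →
      ∃ ψ : Cyc 2 →* MulAut (DihedralGroup (2 ^ ((n - s - t - l + 2) / 2)) ×
          DihedralGroup (2 ^ ((n - s - t - l + 2) / 2))),
        IsExtensionOf (HypertopeGroup n s t l)
          (Cyc (2 ^ (s - 2)) × Cyc (2 ^ (t - 2)) × Cyc (2 ^ (l - 1)))
          ((DihedralGroup (2 ^ ((n - s - t - l + 2) / 2)) ×
            DihedralGroup (2 ^ ((n - s - t - l + 2) / 2))) ⋊[ψ] Cyc 2)) ∧
    (Odd (n - s - t - l) →
      ∃ ψ : Cyc 2 × Cyc 2 →* MulAut (DihedralGroup (2 ^ ((n - s - t - l + 1) / 2)) ×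
          DihedralGroup (2 ^ ((n - s - t - l + 1) / 2))),
        IsExtensionOf (HypertopeGroup n s t l)
          (Cyc (2 ^ (s - 2)) × Cyc (2 ^ (t - 2)) × Cyc (2 ^ (l - 1)))
          ((DihedralGroup (2 ^ ((n - s - t - l + 1) / 2)) ×
            DihedralGroup (2 ^ ((n - s - t - l + 1) / 2))) ⋊[ψ] (Cyc 2 × Cyc 2))):= by
  have hs' : 1 ≤ s := one_le_two.trans hs
  have ht' : 1 ≤ t := one_le_two.trans ht
  have hR := hasRetractions_hypertopeGen (n := n) hs' ht' hl
  have hC := isCGroup_hypertopeGen (n := n) hs' ht' hl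
  obtain ⟨⟨ha, hb, hc, hab, hbc, hac, -⟩, -⟩ :=
    satisfiesRelators_iff.1 (satisfiesRelators_hypertopeGen n s t l)
  obtain ⟨f₁, hf₁⟩ := exists_hom_dihedral_zero_one n s ht' hl
  obtain ⟨f₂, hf₂⟩ := exists_hom_dihedral_one_two n t hs' hl
  obtain ⟨f₃, hf₃⟩ := exists_hom_dihedral_zero_two n l hs' ht'
  have h0 : ({0}ᶜ : Set (Fin 3)) = {1, 2} := by
    ext i
    fin_cases i <;> simp
  have h1 : ({1}ᶜ : Set (Fin 3)) = {0, 2} := by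
    ext i
    fin_cases i <;> simp
  have h2 : ({2}ᶜ : Set (Fin 3)) = {0, 1} := by
    ext i
    fin_cases i <;> simp
  refine ⟨card_hypertopeGroup hs ht hl hstl, hC, hR.isHypertope hC,
    hR.isFlagTransitive hC.1, hR.isRegular hC, ⟨fun x hx => ?_, fun x hx => ?_, fun x hx => ?_⟩,
    orderOf_eq_of_map_eq_r_one hab f₁ (by simp [hf₁]),
    orderOf_eq_of_map_eq_r_one hbc f₂ (by simp [hf₂]),
    orderOf_eq_of_map_eq_r_one hac f₃ (by simp [hf₃]), hR.exists_mulEquiv_autI hC,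
    fun hm => ⟨_, isExtensionOf_evenModel hs ht hl hm⟩,
    fun hm => ⟨_, isExtensionOf_oddModel hs ht hl hm⟩⟩
  · refine hR.residue_isPolygon hC (by decide) h2 ?_ (by positivity) hx
    rw [h2]
    exact card_parabolic_pair ha hb hab f₁ hf₁.1 hf₁.2.1
  · refine hR.residue_isPolygon hC (by decide) h0 ?_ (by positivity) hx
    rw [h0]
    exact card_parabolic_pair hb hc hbc f₂ hf₂.2.1 hf₂.2.2
  · refine hR.residue_isPolygon hC (by decide) h1 ?_ (by positivity) hx
    rw [h1]
    exact card_parabolic_pair ha hc hac f₃ hf₃.1 hf₃.2.2
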